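/- **Theorem 2.2.** Notation. Let $\mathbb D=\{z\in\mathbb C:|z|<1\}$ and $\ell^2=\ell^2(\{0,1,2,\dots\})$ (complex sequences), let $\delta_n\in\ell^2$ be the unit vector with coefficient $1$ in place $n$ and $0$ elsewhere, and for $|\alpha|\le 1$ put $\rho(\alpha)=(1-|\alpha|^2)^{1/2}$ and $\Theta(\alpha)=\begin{pmatrix}\bar\alpha&\rho(\alpha)\\ \rho(\alpha)&-\alpha\end{pmatrix}$. For $\alpha=\{\alpha_n\}_{n\ge0}$ with all $|\alpha_n|<1$, the *proper CMV matrix* with parameters $\alpha$ is the semi-infinite matrix $\mathcal C(\alpha)=\mathcal L\mathcal M$, where $\mathcal L=\Theta(\alpha_0)\oplus\Theta(\alpha_2)\oplus\Theta(\alpha_4)\oplus\cdots$ and $\mathcal M=\mathbf 1_{1\times1}\oplus\Theta(\alpha_1)\oplus\Theta(\alpha_3)\oplus\cdots$. A *cyclic unitary model* $(\mathcal H,U,v_0)$ is a unitary operator $U$ on a complex Hilbert space $\mathcal H$ together with a unit vector $v_0\in\mathcal H$ that is cyclic, i.e. the finite linear combinations of $\{U^nv_0\}_{n\in\mathbb Z}$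 are dense in $\mathcal H$; it is *proper* if $\dim\mathcal H=\infty$. Two models $(\mathcal H,U,v_0)$ and $(\widetilde{\mathcal H},\widetilde U,\tilde v_0)$ are *equivalent* if there is a unitary $W$ from $\mathcal H$ onto $\widetilde{\mathcal H}$ with $Wv_0=\tilde v_0$ and $WUW^{-1}=\widetilde U$. A probability measure $\mu$ on $\partial\mathbb D$ is *nontrivial* if it is not supported on a finite set; its orthonormal polynomials $\varphi_n$ are determined by $\varphi_n(z)=\kappa_nz^n+\text{lower order}$ with $\kappa_n>0$, $\varphi_n\perp\{1,z,\dots,z^{n-1}\}$ and $\|\varphi_n\|=1$ in $L^2(\partial\mathbb D,d\mu)$, and its *Verblunsky coefficients* are the $\alpha_n\in\mathbb D$, $n\ge 0$, with $$\rho(\alpha_n)\,\varphi_{n+1}(z)=z\varphi_n(z)-\bar\alpha_n\varphi_n^*(z),\qquad \varphi_n^*(z)=z^n\,\overline{\varphi_n(1/\bar z)}.$$ (a) Every proper CMV matrix is the matrix, with respect to $\{\delta_n\}_{n\ge0}$, of exactly one unitary operator $\mathcal C$ on $\ell^2$, and $\delta_0$ is cyclic for $\mathcal C$; thus $(\ell^2,\mathcal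 C,\delta_0)$ is a proper cyclic unitary model. (b) For every proper cyclic unitary model $(\mathcal H,U,v_0)$ there is exactly one proper CMV matrix $\mathcal C$ such that $(\ell^2,\mathcal C,\delta_0)$ is equivalent to $(\mathcal H,U,v_0)$. (c) (Verblunsky's theorem) Every sequence $\{\alpha_n\}_{n\ge0}\in\mathbb D^\infty$ is the sequence of Verblunsky coefficients of some nontrivial probability measure on $\partial\mathbb D$. -/

import Mathlib

open scoped ComplexConjugate

namespace CMV

/-! ### Cyclic unitary models -/

/-- A cyclic unitary model `(H, U, v₀)`: a unitary operator `U` on `H` with a unit vector `v₀`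
such that the finite linear combinations of the `U ^ n v₀`, `n ∈ ℤ`, are dense in `H`. -/
structure IsCyclicUnitaryModel {H : Type*} [NormedAddCommGroup H] [InnerProductSpace ℂ H]
    (U : H ≃ₗᵢ[ℂ] H) (v₀ : H) : Prop where
  norm_eq_one : ‖v₀‖ = 1
  cyclic : Dense (Submodule.span ℂ (Set.range fun n : ℤ => (U ^ n) v₀) : Set H)

/-- A cyclic unitary model is proper if the space is infinite-dimensional. -/
structure IsProperCyclicUnitaryModel {H : Type*} [NormedAddCommGroup H] [InnerProductSpace ℂ H]
    (U : H ≃ₗᵢ[ℂ] H) (v₀ : H) : Prop extends IsCyclicUnitaryModel U v₀ where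
  infinite_dimensional : ¬ FiniteDimensional ℂ H

/-- Equivalence of `(H, U, v₀)` and `(H', U', v₀')`: there is a unitary `W` from `H` onto `H'`
with `W v₀ = v₀'` and `W U W⁻¹ = U'`. -/
def ModelEquiv {H H' : Type*} [NormedAddCommGroup H] [InnerProductSpace ℂ H]
    [NormedAddCommGroup H'] [InnerProductSpace ℂ H']
    (U : H ≃ₗᵢ[ℂ] H) (v₀ : H) (U' : H' ≃ₗᵢ[ℂ] H') (v₀' : H') : Prop :=
  ∃ W : H ≃ₗᵢ[ℂ] H', W v₀ = v₀' ∧ ∀ y : H', W (U (W.symm y)) = U' y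

/-! ### CMV matrices -/

/-- `ρ = (1 - |α|²)^{1/2}`. -/
noncomputable def rho (a : ℂ) : ℝ := Real.sqrt (1 - ‖a‖ ^ 2)

/-- The `2 × 2` block `Θ(α)`. -/
noncomputable def theta (a : ℂ) : Matrix (Fin 2) (Fin 2) ℂ :=
  !![conj a, (rho a : ℂ); (rho a : ℂ), -a]

/-- The semi-infinite block diagonal matrix `B₀ ⊕ B₁ ⊕ B₂ ⊕ ⋯` with `2 × 2` blocks. -/
def directSum (B : ℕ → Matrix (Fin 2) (Fin 2) ℂ) : Matrix ℕ ℕ ℂ := fun m k =>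
  if m / 2 = k / 2 then B (m / 2) (Fin.ofNat 2 m) (Fin.ofNat 2 k) else 0

/-- The matrix `1 ⊕ A` with a `1 × 1` block in front of `A`. -/
def oneDirectSum (A : Matrix ℕ ℕ ℂ) : Matrix ℕ ℕ ℂ
  | 0, 0 => 1
  | 0, _ + 1 => 0
  | _ + 1, 0 => 0
  | m + 1, k + 1 => A m k

/-- `ℒ = Θ(α₀) ⊕ Θ(α₂) ⊕ Θ(α₄) ⊕ ⋯`. -/
noncomputable def matL (α : ℕ → ℂ) : Matrix ℕ ℕ ℂ :=
  directSum fun j => theta (α (2 * j))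

/-- `ℳ = 1 ⊕ Θ(α₁) ⊕ Θ(α₃) ⊕ ⋯`. -/
noncomputable def matM (α : ℕ → ℂ) : Matrix ℕ ℕ ℂ :=
  oneDirectSum (directSum fun j => theta (α (2 * j + 1)))

/-- The entries of the matrix product `𝒞 = ℒ ℳ`. The sum over all `j` is finite, since
`ℒ m j = 0` for `j ≥ m + 2` (`matL_eq_zero`). -/
noncomputable def matC (α : ℕ → ℂ) : Matrix ℕ ℕ ℂ := fun m k =>
  ∑ j ∈ Finset.range (m + 2), matL α m j * matM α j k

theorem matL_eq_zero (α : ℕ → ℂ) {m j : ℕ} (h : m + 2 ≤ j) : matL α m j = 0 := by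
  have h' : m / 2 ≠ j / 2 := by omega
  simp [matL, directSum, h']

/-- The Hilbert space `ℓ² = ℓ²({0, 1, 2, …})` of complex sequences. -/
abbrev ell2 : Type := lp (fun _ : ℕ => ℂ) 2

/-- The unit vector `δₙ` of `ℓ²`, with coefficient `1` in place `n` and `0` elsewhere. -/
noncomputable def delta (n : ℕ) : ell2 := lp.single 2 n 1

/-- `C` is the operator on `ℓ²` with matrix `A`: the coefficient of `C δₖ` in place `m` is
`A m k`. -/
def HasMatrix (C : ell2 ≃ₗᵢ[ℂ] ell2) (A : Matrix ℕ ℕ ℂ) : Prop :=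
  ∀ m k : ℕ, C (delta k) m = A m k

/-- The unitary operators on `ℓ²` that are given by proper CMV matrices (all `|αₙ| < 1`). -/
def IsProperCMV (C : ell2 ≃ₗᵢ[ℂ] ell2) : Prop :=
  ∃ α : ℕ → ℂ, (∀ n, ‖α n‖ < 1) ∧ HasMatrix C (matC α)

/-! ### Verblunsky coefficients of measures on the unit circle -/

open MeasureTheory

/-- The unit circle carries its Borel σ-algebra. -/
noncomputable instance instMeasurableSpaceCircle : MeasurableSpace Circle := borel Circle

instance instBorelSpaceCircle : BorelSpace Circle := ⟨rfl⟩

/-- A measure on the unit circle is nontrivial if it is not supported on a finite set. -/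
def IsNontrivialMeasure (μ : Measure Circle) : Prop :=
  ∀ s : Set Circle, s.Finite → μ sᶜ ≠ 0

/-- `φ` is the sequence of orthonormal polynomials of `μ`: `φₙ = κₙ zⁿ + lower order` with
`κₙ > 0`, `φₙ ⊥ {1, z, …, zⁿ⁻¹}` and `‖φₙ‖ = 1` in `L²(μ)`. -/
structure IsOrthonormalPolynomials (μ : Measure Circle) (φ : ℕ → Polynomial ℂ) : Prop where
  natDegree_eq : ∀ n, (φ n).natDegree = n
  leadingCoeff_pos : ∀ n, ∃ κ : ℝ, 0 < κ ∧ (φ n).leadingCoeff = (κ : ℂ)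
  orthogonal : ∀ n j, j < n → ∫ z : Circle, conj ((z : ℂ) ^ j) * (φ n).eval (z : ℂ) ∂μ = 0
  normalized : ∀ n, ∫ z : Circle, ‖(φ n).eval (z : ℂ)‖ ^ 2 ∂μ = 1

/-- The Szegő dual `Pₙ*(z) = ∑_{j ≤ n} conj(c_{n-j}) zʲ` of `Pₙ(z) = ∑_{j ≤ n} cⱼ zʲ`. -/
noncomputable def szegoDual (n : ℕ) (P : Polynomial ℂ) : Polynomial ℂ :=
  ∑ j ∈ Finset.range (n + 1), Polynomial.monomial j (conj (P.coeff (n - j)))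

/-- `α` is the sequence of Verblunsky coefficients of `μ`: `αₙ ∈ 𝔻`, and the orthonormal
polynomials of `μ` satisfy the Szegő recursion `ρₙ φₙ₊₁ = z φₙ - conj(αₙ) φₙ*`. -/
def IsVerblunskyCoefficients (μ : Measure Circle) (α : ℕ → ℂ) : Prop :=
  (∀ n, ‖α n‖ < 1) ∧ ∃ φ : ℕ → Polynomial ℂ, IsOrthonormalPolynomials μ φ ∧
    ∀ n, Polynomial.C (rho (α n) : ℂ) * φ (n + 1) =
      Polynomial.X * φ n - Polynomial.C (conj (α n)) * szegoDual n (φ n)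

end CMV

namespace CMV

/-! ### Rotation of consecutive pairs -/

/-! The Szegő recursion is run inside the Hilbert space. Starting from `v₀` it produces vectors φₙ,
φₙ*, and the coefficient of each step is taken to be ⟪U φₙ, φₙ*⟫ (`modelCoeff`), so the coefficients
are unitary invariants. In a proper model they lie in the disk: otherwise some nonzero polynomial in
`U` kills `v₀`, and cyclicity forces finite dimension
(`IsProperCyclicUnitaryModel.norm_modelCoeff_lt_one`).

A factorization of `U` as ℒℳ amounts to two families χ and x linked by the blocks Θ (`IsCMVPair`).
Solving each block relation turns it into a Szegő step (`isCMVPair_iff`), so up to powers of `U` the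
members of χ and x are the φₙ and φₙ*. Hence a CMV operator gives back its own parameters as the
coefficients at δ₀, which yields uniqueness, and each δₙ lies in the span of the orbit of δ₀, which
yields cyclicity. Conversely, in a proper model the vectors U⁻ᵏφ*₂ₖ and U⁻ᵏφ₂ₖ₊₁ form an orthonormal
basis (`orthonormal_cmvBasis`) in which `U` has a CMV matrix.

For Verblunsky's theorem, take the spectral measure of δ₀ for the CMV operator with parameters α.
Polynomials in L²(μ) have the same inner products as the vectors P(U)δ₀, so the vector recursion
becomes the polynomial one with the same coefficients. -/

theorem rho_mul_self {a : ℂ} (h : ‖a‖ ≤ 1) : (rho a : ℂ) * rho a = 1 - a * conj a := by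
  rw [← Complex.ofReal_mul, rho, Real.mul_self_sqrt (by nlinarith [norm_nonneg a]),
    Complex.mul_conj, Complex.normSq_eq_norm_sq]
  push_cast
  rfl

theorem rho_pos {a : ℂ} (h : ‖a‖ < 1) : 0 < rho a :=
  Real.sqrt_pos.2 (by nlinarith [norm_nonneg a])

theorem rho_ne_zero {a : ℂ} (h : ‖a‖ < 1) : (rho a : ℂ) ≠ 0 :=
  Complex.ofReal_ne_zero.2 (rho_pos h).ne'

theorem rho_conj (a : ℂ) : rho (conj a) = rho a := by simp [rho]

section Module

variable {E : Type*} [AddCommGroup E] [Module ℂ E]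

/-- The relation `(c, d) = (a, b) Θ(α)` solved for `b` and `d` in terms of `a` and `c`. -/
theorem theta_apply_iff {α : ℂ} (h : ‖α‖ < 1) {a b c d : E} :
    (c = conj α • a + (rho α : ℂ) • b ∧ d = (rho α : ℂ) • a - α • b) ↔
      (b = (rho α : ℂ)⁻¹ • (c - conj α • a) ∧ d = (rho α : ℂ)⁻¹ • (a - α • c)) := by
  have h0 := rho_ne_zero h
  have h1 := rho_mul_self h.le
  constructor
  · rintro ⟨rfl, rfl⟩
    constructor
    · match_scalars <;> field_simp
      ring
    · match_scalars <;> field_simp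
      linear_combination h1
  · rintro ⟨rfl, rfl⟩
    constructor
    · match_scalars <;> field_simp
      ring
    · match_scalars <;> field_simp
      linear_combination -h1

/-- The blocks `Θ(β₀), Θ(β₁), …` applied to the consecutive pairs `(e₀, e₁), (e₂, e₃), …`. -/
noncomputable def rotate (β : ℕ → ℂ) (e : ℕ → E) (n : ℕ) : E :=
  if n % 2 = 0 then conj (β (n / 2)) • e n + (rho (β (n / 2)) : ℂ) • e (n + 1)
  else (rho (β (n / 2)) : ℂ) • e (n - 1) - β (n / 2) • e n

theorem rotate_even (β : ℕ → ℂ) (e : ℕ → E) (k : ℕ) :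
    rotate β e (2 * k) = conj (β k) • e (2 * k) + (rho (β k) : ℂ) • e (2 * k + 1) := by
  simp [rotate]

theorem rotate_odd (β : ℕ → ℂ) (e : ℕ → E) (k : ℕ) :
    rotate β e (2 * k + 1) = (rho (β k) : ℂ) • e (2 * k) - β k • e (2 * k + 1) := by
  have h : (2 * k + 1) / 2 = k := by omega
  simp [rotate, h, Nat.add_mod]

/-- Θ(β) is symmetric and unitary, so its inverse is Θ(conj β). Invertibility is what makes rotated
families have the same span. -/
theorem rotate_conj_rotate {β : ℕ → ℂ} (hβ : ∀ n, ‖β n‖ < 1) (e : ℕ → E) :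
    rotate (fun n => conj (β n)) (rotate β e) = e := by
  funext n
  obtain ⟨k, rfl | rfl⟩ := Nat.even_or_odd' n
  · rw [rotate_even, rotate_even, rotate_odd, rho_conj]
    have h1 := rho_mul_self (hβ k).le
    match_scalars
    · simp only [RCLike.conj_conj]
      linear_combination h1
    · simp only [RCLike.conj_conj]
      ring
  · rw [rotate_odd, rotate_even, rotate_odd, rho_conj]
    have h1 := rho_mul_self (hβ k).le
    match_scalars
    · ring
    · linear_combination h1

theorem rotate_mem_span (β : ℕ → ℂ) (e : ℕ → E) (n : ℕ) :
    rotate β e n ∈ Submodule.span ℂ (Set.range e) := by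
  have h : ∀ n, e n ∈ Submodule.span ℂ (Set.range e) := fun n =>
    Submodule.subset_span (Set.mem_range_self n)
  rw [rotate]
  split_ifs
  · exact add_mem (Submodule.smul_mem _ _ (h _)) (Submodule.smul_mem _ _ (h _))
  · exact sub_mem (Submodule.smul_mem _ _ (h _)) (Submodule.smul_mem _ _ (h _))

theorem span_rotate {β : ℕ → ℂ} (hβ : ∀ n, ‖β n‖ < 1) (e : ℕ → E) :
    Submodule.span ℂ (Set.range (rotate β e)) = Submodule.span ℂ (Set.range e) := by
  apply le_antisymm
  · rw [Submodule.span_le]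
    rintro _ ⟨n, rfl⟩
    exact rotate_mem_span β e n
  · rw [Submodule.span_le]
    rintro _ ⟨n, rfl⟩
    have h := rotate_mem_span (fun n => conj (β n)) (rotate β e) n
    rwa [rotate_conj_rotate hβ] at h

/-- The family `e₀, rotate β (e₁, e₂, …)`. -/
noncomputable def rotateSucc (β : ℕ → ℂ) (e : ℕ → E) : ℕ → E
  | 0 => e 0
  | n + 1 => rotate β (fun i => e (i + 1)) n

theorem rotateSucc_conj_rotateSucc {β : ℕ → ℂ} (hβ : ∀ n, ‖β n‖ < 1) (e : ℕ → E) :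
    rotateSucc (fun n => conj (β n)) (rotateSucc β e) = e := by
  funext n
  cases n with
  | zero => rfl
  | succ n => exact congrFun (rotate_conj_rotate hβ fun i => e (i + 1)) n

theorem rotateSucc_mem_span (β : ℕ → ℂ) (e : ℕ → E) (n : ℕ) :
    rotateSucc β e n ∈ Submodule.span ℂ (Set.range e) := by
  cases n with
  | zero => exact Submodule.subset_span (Set.mem_range_self 0)
  | succ n =>
    refine Submodule.span_mono ?_ (rotate_mem_span β (fun i => e (i + 1)) n)
    rintro _ ⟨i, rfl⟩
    exact ⟨i + 1, rfl⟩

theorem span_rotateSucc {β : ℕ → ℂ} (hβ : ∀ n, ‖β n‖ < 1) (e : ℕ → E) :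
    Submodule.span ℂ (Set.range (rotateSucc β e)) = Submodule.span ℂ (Set.range e) := by
  apply le_antisymm
  · rw [Submodule.span_le]
    rintro _ ⟨n, rfl⟩
    exact rotateSucc_mem_span β e n
  · rw [Submodule.span_le]
    rintro _ ⟨n, rfl⟩
    have h := rotateSucc_mem_span (fun n => conj (β n)) (rotateSucc β e) n
    rwa [rotateSucc_conj_rotateSucc hβ] at h

theorem map_rotate {F : Type*} [AddCommGroup F] [Module ℂ F] (f : E →ₗ[ℂ] F) (β : ℕ → ℂ)
    (e : ℕ → E) (n : ℕ) : f (rotate β e n) = rotate β (fun i => f (e i)) n := by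
  rw [rotate, rotate]
  split_ifs <;> simp

theorem map_rotateSucc {F : Type*} [AddCommGroup F] [Module ℂ F] (f : E →ₗ[ℂ] F) (β : ℕ → ℂ)
    (e : ℕ → E) (n : ℕ) : f (rotateSucc β e n) = rotateSucc β (fun i => f (e i)) n := by
  cases n with
  | zero => rfl
  | succ n => exact map_rotate f β (fun i => e (i + 1)) n

theorem rotate_eq_sum (β : ℕ → ℂ) (e : ℕ → E) {n N : ℕ} (hN : n + 2 ≤ N) :
    rotate β e n = ∑ j ∈ Finset.range N, directSum (fun i => theta (β i)) j n • e j := by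
  have key : ∀ k, 2 * k + 2 ≤ N → ∀ r : Fin 2,
      ∑ j ∈ Finset.range N, directSum (fun i => theta (β i)) j (2 * k + r) • e j =
        theta (β k) 0 r • e (2 * k) + theta (β k) 1 r • e (2 * k + 1) := by
    intro k hk r
    have hr := r.2
    rw [← Finset.sum_subset (s₁ := {2 * k, 2 * k + 1})]
    · rw [Finset.sum_pair (by omega)]
      have h1 : (2 * k + 1) / 2 = k := by omega
      have h2 : (2 * k + (r : ℕ)) / 2 = k := by omega
      have h3 : Fin.ofNat 2 (2 * k + r) = r := by ext; simp [Fin.ofNat]; omega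
      have h4 : Fin.ofNat 2 (2 * k) = 0 := by ext; simp [Fin.ofNat]
      have h5 : Fin.ofNat 2 (2 * k + 1) = 1 := by ext; simp [Fin.ofNat]
      simp only [directSum, h1, h2, h3, h4, h5]
      simp
    · intro j hj
      simp only [Finset.mem_insert, Finset.mem_singleton] at hj
      rw [Finset.mem_range]
      omega
    · intro j _ hj
      simp only [Finset.mem_insert, Finset.mem_singleton] at hj
      have : j / 2 ≠ (2 * k + (r : ℕ)) / 2 := by omega
      simp [directSum, this]
  obtain ⟨k, rfl | rfl⟩ := Nat.even_or_odd' n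
  · have := key k (by omega) 0
    rw [Fin.val_zero, add_zero] at this
    rw [this, rotate_even]
    simp [theta]
  · have := key k (by omega) 1
    rw [Fin.val_one] at this
    rw [this, rotate_odd]
    simp [theta, sub_eq_add_neg]

theorem rotateSucc_eq_sum (β : ℕ → ℂ) (e : ℕ → E) {n N : ℕ} (hN : n + 2 ≤ N) :
    rotateSucc β e n =
      ∑ j ∈ Finset.range N, oneDirectSum (directSum fun i => theta (β i)) j n • e j := by
  obtain ⟨N, rfl⟩ : ∃ M, N = M + 1 := ⟨N - 1, by omega⟩
  rw [Finset.sum_range_succ']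
  cases n with
  | zero => simp [oneDirectSum, rotateSucc]
  | succ n => simp [oneDirectSum, rotateSucc, rotate_eq_sum β _ (show n + 2 ≤ N by omega)]

end Module

/-! ### Orthonormality of rotated families -/

section Inner

variable {E : Type*} [NormedAddCommGroup E] [InnerProductSpace ℂ E]

theorem orthonormal_rotate {β : ℕ → ℂ} (hβ : ∀ n, ‖β n‖ < 1) {e : ℕ → E}
    (he : Orthonormal ℂ e) : Orthonormal ℂ (rotate β e) := by
  rw [orthonormal_iff_ite] at he ⊢
  intro i j
  obtain ⟨k, rfl | rfl⟩ := Nat.even_or_odd' i <;> obtain ⟨l, rfl | rfl⟩ := Nat.even_or_odd' j <;>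
  simp only [rotate_even, rotate_odd, inner_add_left, inner_add_right, inner_sub_left,
    inner_sub_right, inner_smul_left, inner_smul_right, he] <;>
  have h1 : 2 * k ≠ 2 * l + 1 := by omega
  all_goals
    have h2 : 2 * k + 1 ≠ 2 * l := by omega
    have h3 := rho_mul_self (hβ k).le
    by_cases hkl : k = l
    · subst hkl
      simp
      try first | ring1 | linear_combination h3
    · simp [h1, h2, hkl]

theorem orthonormal_rotateSucc {β : ℕ → ℂ} (hβ : ∀ n, ‖β n‖ < 1) {e : ℕ → E}
    (he : Orthonormal ℂ e) : Orthonormal ℂ (rotateSucc β e) := by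
  have h1 := orthonormal_iff_ite.1
    (orthonormal_rotate hβ (he.comp (fun i => i + 1) (add_left_injective 1)))
  have h0 : ∀ n, inner ℂ (e 0) (rotate β (fun i => e (i + 1)) n) = 0 := by
    intro n
    have h : ∀ i, inner ℂ (e 0) (e (i + 1)) = 0 := fun i => he.2 (by omega)
    obtain ⟨k, rfl | rfl⟩ := Nat.even_or_odd' n
    · simp [rotate_even, h]
    · simp [rotate_odd, h]
  rw [orthonormal_iff_ite]
  intro i j
  cases i with
  | zero =>
    cases j with
    | zero => simpa [rotateSucc] using orthonormal_iff_ite.1 he 0 0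
    | succ j => simpa [rotateSucc] using h0 j
  | succ i =>
    cases j with
    | zero => simpa [rotateSucc] using inner_eq_zero_symm.1 (h0 i)
    | succ j => simpa [rotateSucc, Function.comp_def] using h1 i j

end Inner

/-! ### The two bases of a CMV operator -/

section Pair

variable {H : Type*} [NormedAddCommGroup H] [InnerProductSpace ℂ H]

/-- The families `χ` and `x` satisfy the relations of the CMV and the alternate CMV basis of `U`
with parameters `α`: `U xₙ = ∑ₘ ℒₘₙ χₘ` and `χₙ = ∑ₘ ℳₘₙ xₘ`. -/
structure IsCMVPair (U : H ≃ₗᵢ[ℂ] H) (α : ℕ → ℂ) (χ x : ℕ → H) : Prop where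
  map_eq : ∀ n, U (x n) = rotate (fun k => α (2 * k)) χ n
  eq_rotateSucc : ∀ n, χ n = rotateSucc (fun k => α (2 * k + 1)) x n

/-- Frees the summation range from the row index, so that it can also cover the support of a column
of ℳ. -/
theorem matC_eq_sum (α : ℕ → ℂ) {m k N : ℕ} (hN : m + 2 ≤ N) :
    matC α m k = ∑ j ∈ Finset.range N, matL α m j * matM α j k := by
  refine Finset.sum_subset (Finset.range_mono hN) fun j _ hj => ?_
  rw [matL_eq_zero α (by simpa using hj), zero_mul]

theorem inner_rotate {e : ℕ → H} (he : Orthonormal ℂ e) (β : ℕ → ℂ) (m n : ℕ) :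
    inner ℂ (e m) (rotate β e n) = directSum (fun i => theta (β i)) m n := by
  rw [rotate_eq_sum β e (show n + 2 ≤ m + n + 2 by omega), inner_sum]
  simp only [inner_smul_right, orthonormal_iff_ite.1 he]
  rw [Finset.sum_eq_single m]
  · simp
  · intro j _ hj
    simp [hj.symm]
  · intro hm
    exact absurd (Finset.mem_range.2 (by omega)) hm

/-- Expanding χₖ in the family x uses column k of ℳ, and expanding each `U (x j)` in χ uses column j
of ℒ. -/
theorem IsCMVPair.inner_map {U : H ≃ₗᵢ[ℂ] H} {α : ℕ → ℂ} {χ x : ℕ → H} (h : IsCMVPair U α χ x)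
    (hχ : Orthonormal ℂ χ) (m k : ℕ) : inner ℂ (χ m) (U (χ k)) = matC α m k := by
  rw [h.eq_rotateSucc k, rotateSucc_eq_sum _ _ (show k + 2 ≤ m + k + 2 by omega), map_sum,
    inner_sum, matC_eq_sum α (show m + 2 ≤ m + k + 2 by omega)]
  refine Finset.sum_congr rfl fun j _ => ?_
  rw [map_smul, inner_smul_right, h.map_eq, inner_rotate hχ, mul_comm]
  rfl

/-- The family `U ∘ x` is a rotation of χ, and `U` preserves inner products. -/
theorem IsCMVPair.orthonormal {U : H ≃ₗᵢ[ℂ] H} {α : ℕ → ℂ} (hα : ∀ n, ‖α n‖ < 1) {χ x : ℕ → H}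
    (h : IsCMVPair U α χ x) (hχ : Orthonormal ℂ χ) : Orthonormal ℂ x := by
  have h1 := orthonormal_rotate (fun k => hα (2 * k)) hχ
  rw [← funext h.map_eq, orthonormal_iff_ite] at h1
  rw [orthonormal_iff_ite]
  simpa only [LinearIsometryEquiv.inner_map_map] using h1

/-- Equality, rather than mere inclusion, of the image with `S` is what handles negative powers. -/
theorem zpow_mem_of_map_eq {U : H ≃ₗᵢ[ℂ] H} {S : Submodule ℂ H}
    (hS : S.map (U.toLinearEquiv : H →ₗ[ℂ] H) = S) {y : H} (hy : y ∈ S) (n : ℤ) :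
    (U ^ n) y ∈ S := by
  have h3 : ∀ y ∈ S, U y ∈ S := fun y hy => hS ▸ Submodule.mem_map_of_mem hy
  have h4 : ∀ y ∈ S, U⁻¹ y ∈ S := by
    intro y hy
    rw [← hS] at hy
    obtain ⟨z, hz, rfl⟩ := hy
    have : U⁻¹ (U z) = z := U.symm_apply_apply z
    simpa [this] using hz
  induction n with
  | zero => simpa using hy
  | succ n ih =>
    rw [add_comm, zpow_add, zpow_one]
    exact h3 _ ih
  | pred n ih =>
    rw [sub_eq_add_neg, add_comm, zpow_add, zpow_neg_one]
    exact h4 _ ih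

/-- The span of `χ` contains all `Uⁿ χ₀`. -/
theorem IsCMVPair.zpow_mem_span {U : H ≃ₗᵢ[ℂ] H} {α : ℕ → ℂ} (hα : ∀ n, ‖α n‖ < 1) {χ x : ℕ → H}
    (h : IsCMVPair U α χ x) (n : ℤ) : (U ^ n) (χ 0) ∈ Submodule.span ℂ (Set.range χ) := by
  set S := Submodule.span ℂ (Set.range χ) with hS
  -- Rotations preserve spans, so χ, x and `U ∘ x` all span `S`; hence `U` maps `S` onto itself.
  have h1 : Submodule.span ℂ (Set.range x) = S := by
    rw [hS, funext h.eq_rotateSucc, span_rotateSucc fun k => hα (2 * k + 1)]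
  have h2 : S.map (U.toLinearEquiv : H →ₗ[ℂ] H) = S := by
    conv_lhs => rw [← h1]
    rw [Submodule.map_span, ← Set.range_comp, hS, ← span_rotate (fun k => hα (2 * k)) χ,
      ← funext h.map_eq]
    rfl
  exact zpow_mem_of_map_eq h2 (Submodule.subset_span (Set.mem_range_self 0)) n

end Pair

/-! ### Operators on `ℓ²` -/

theorem delta_apply_inner (k : ℕ) (f : ell2) : inner ℂ (delta k) f = f k := by
  simp [delta, lp.inner_single_left]

theorem orthonormal_delta : Orthonormal ℂ delta := by
  rw [orthonormal_iff_ite]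
  intro i j
  rw [delta_apply_inner, delta, lp.single_apply]
  by_cases h : i = j
  · subst h; simp
  · simp [h]

theorem dense_span_delta : (Submodule.span ℂ (Set.range delta)).topologicalClosure = ⊤ := by
  rw [Submodule.topologicalClosure_eq_top_iff, Submodule.eq_bot_iff]
  intro f hf
  ext n
  rw [← delta_apply_inner]
  simpa using hf (delta n) (Submodule.subset_span (Set.mem_range_self n))

/-- The unitary operator that maps `δₙ` to the members of an orthonormal basis. -/
theorem exists_unitary_map_delta {e : ℕ → ell2} (he : Orthonormal ℂ e)
    (hspan : Submodule.span ℂ (Set.range e) = Submodule.span ℂ (Set.range delta)) :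
    ∃ V : ell2 ≃ₗᵢ[ℂ] ell2, ∀ n, V (delta n) = e n := by
  have h : ⊤ ≤ (Submodule.span ℂ (Set.range e)).topologicalClosure := by
    rw [hspan, dense_span_delta]
  refine ⟨(HilbertBasis.mk he h).repr.symm, fun n => ?_⟩
  have := (HilbertBasis.mk he h).repr_symm_single n
  rw [HilbertBasis.coe_mk] at this
  exact this

theorem hasMatrix_iff {C : ell2 ≃ₗᵢ[ℂ] ell2} {A : Matrix ℕ ℕ ℂ} :
    HasMatrix C A ↔ ∀ m k, inner ℂ (delta m) (C (delta k)) = A m k := by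
  simp only [HasMatrix, delta_apply_inner]

theorem HasMatrix.unique {C C' : ell2 ≃ₗᵢ[ℂ] ell2} {A : Matrix ℕ ℕ ℂ} (h : HasMatrix C A)
    (h' : HasMatrix C' A) : C = C' := by
  have h1 : Set.EqOn (C : ell2 →L[ℂ] ell2) (C' : ell2 →L[ℂ] ell2) (Set.range delta) := by
    rintro _ ⟨k, rfl⟩
    ext m
    exact (h m k).trans (h' m k).symm
  have h2 : (C : ell2 →L[ℂ] ell2) = (C' : ell2 →L[ℂ] ell2) :=
    ContinuousLinearMap.ext_on
      ((Submodule.dense_iff_topologicalClosure_eq_top).2 dense_span_delta) h1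
  ext1 f
  exact congrArg (fun T : ell2 →L[ℂ] ell2 => T f) h2

/-- Every proper CMV matrix is the matrix of a unitary operator, together with its alternate
CMV basis. -/
theorem exists_unitary_isCMVPair {α : ℕ → ℂ} (hα : ∀ n, ‖α n‖ < 1) :
    ∃ (C : ell2 ≃ₗᵢ[ℂ] ell2) (x : ℕ → ell2), IsCMVPair C α delta x := by
  obtain ⟨L, hL⟩ := exists_unitary_map_delta
    (orthonormal_rotate (fun k => hα (2 * k)) orthonormal_delta)
    (span_rotate (fun k => hα (2 * k)) delta)
  obtain ⟨M, hM⟩ := exists_unitary_map_delta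
    (orthonormal_rotateSucc (fun k => hα (2 * k + 1)) orthonormal_delta)
    (span_rotateSucc (fun k => hα (2 * k + 1)) delta)
  -- The operator is L ∘ M, and the alternate basis is M⁻¹δₙ, which it sends to L δₙ.
  refine ⟨M.trans L, fun n => M.symm (delta n), ⟨fun n => ?_, fun n => ?_⟩⟩
  · simp [hL]
  · apply M.injective
    rw [hM]
    have := map_rotateSucc M.toLinearEquiv.toLinearMap (fun k => α (2 * k + 1))
      (fun n => M.symm (delta n)) n
    simpa using this.symm

/-- A matrix determines its operator, so any operator with this matrix is the one already
constructed and inherits its alternate basis. -/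
theorem hasMatrix_matC_iff {α : ℕ → ℂ} (hα : ∀ n, ‖α n‖ < 1) {C : ell2 ≃ₗᵢ[ℂ] ell2} :
    HasMatrix C (matC α) ↔ ∃ x : ℕ → ell2, IsCMVPair C α delta x := by
  constructor
  · intro h
    obtain ⟨C', x, hx⟩ := exists_unitary_isCMVPair hα
    have h' : HasMatrix C' (matC α) := hasMatrix_iff.2 (hx.inner_map orthonormal_delta)
    rw [h.unique h']
    exact ⟨x, hx⟩
  · rintro ⟨x, hx⟩
    exact hasMatrix_iff.2 (hx.inner_map orthonormal_delta)

theorem existsUnique_hasMatrix {α : ℕ → ℂ} (hα : ∀ n, ‖α n‖ < 1) :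
    ∃! C : ell2 ≃ₗᵢ[ℂ] ell2, HasMatrix C (matC α) := by
  obtain ⟨C, hC⟩ := exists_unitary_isCMVPair hα
  exact ⟨C, (hasMatrix_matC_iff hα).2 hC,
    fun C' h' => h'.unique ((hasMatrix_matC_iff hα).2 hC)⟩

/-! ### The Szegő recursion in a cyclic model -/

section Szego

variable {H : Type*} [NormedAddCommGroup H] [InnerProductSpace ℂ H]

/-- One step `(φₙ, φₙ*) ↦ (φₙ₊₁, φₙ₊₁*)` of the Szegő recursion with coefficient `a`. -/
noncomputable def szegoStep (U : H ≃ₗᵢ[ℂ] H) (a : ℂ) (p : H × H) : H × H :=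
  ((rho a : ℂ)⁻¹ • (U p.1 - conj a • p.2), (rho a : ℂ)⁻¹ • (p.2 - a • U p.1))

/-- The vectors `(φₙ, φₙ*)` of the model `(H, U, v₀)`, where the coefficient of the `n`-th step of
the Szegő recursion is `⟪U φₙ, φₙ*⟫`. -/
noncomputable def szego (U : H ≃ₗᵢ[ℂ] H) (v₀ : H) : ℕ → H × H
  | 0 => (v₀, v₀)
  | n + 1 => szegoStep U (inner ℂ (U (szego U v₀ n).1) (szego U v₀ n).2) (szego U v₀ n)

/-- The Verblunsky coefficients of the model `(H, U, v₀)`. -/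
noncomputable def modelCoeff (U : H ≃ₗᵢ[ℂ] H) (v₀ : H) (n : ℕ) : ℂ :=
  inner ℂ (U (szego U v₀ n).1) (szego U v₀ n).2

theorem szego_succ (U : H ≃ₗᵢ[ℂ] H) (v₀ : H) (n : ℕ) :
    szego U v₀ (n + 1) = szegoStep U (modelCoeff U v₀ n) (szego U v₀ n) := rfl

/-- The recursion uses only `U`, `v₀` and inner products, so an intertwining unitary carries it
along. -/
theorem szego_map {H' : Type*} [NormedAddCommGroup H'] [InnerProductSpace ℂ H']
    {U : H ≃ₗᵢ[ℂ] H} {U' : H' ≃ₗᵢ[ℂ] H'} (W : H ≃ₗᵢ[ℂ] H') (hW : ∀ y, W (U y) = U' (W y))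
    (v₀ : H) (n : ℕ) :
    szego U' (W v₀) n = (W (szego U v₀ n).1, W (szego U v₀ n).2) := by
  induction n with
  | zero => rfl
  | succ n ih =>
    rw [szego_succ, szego_succ, modelCoeff, ih]
    simp [szegoStep, ← hW, modelCoeff]

theorem modelCoeff_map {H' : Type*} [NormedAddCommGroup H'] [InnerProductSpace ℂ H']
    {U : H ≃ₗᵢ[ℂ] H} {U' : H' ≃ₗᵢ[ℂ] H'} (W : H ≃ₗᵢ[ℂ] H') (hW : ∀ y, W (U y) = U' (W y))
    (v₀ : H) : modelCoeff U' (W v₀) = modelCoeff U v₀ := by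
  funext n
  simp [modelCoeff, szego_map W hW, ← hW]

theorem ModelEquiv.modelCoeff_eq {H' : Type*} [NormedAddCommGroup H'] [InnerProductSpace ℂ H']
    {U : H ≃ₗᵢ[ℂ] H} {U' : H' ≃ₗᵢ[ℂ] H'} {v₀ : H} {v₀' : H'} (h : ModelEquiv U v₀ U' v₀') :
    modelCoeff U' v₀' = modelCoeff U v₀ := by
  obtain ⟨W, rfl, hW⟩ := h
  exact modelCoeff_map W (fun y => by simp [← hW]) v₀

theorem map_pow_apply (U : H ≃ₗᵢ[ℂ] H) (k : ℕ) (y : H) : U ((U ^ k) y) = (U ^ k) (U y) :=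
  congrArg (fun V : H ≃ₗᵢ[ℂ] H => V y) ((Commute.refl U).pow_right k).eq

theorem map_inv_pow_apply (U : H ≃ₗᵢ[ℂ] H) (k : ℕ) (y : H) :
    U ((U ^ k)⁻¹ y) = (U ^ k)⁻¹ (U y) :=
  congrArg (fun V : H ≃ₗᵢ[ℂ] H => V y) ((Commute.refl U).pow_right k).inv_right.eq

theorem szegoStep_pow (U : H ≃ₗᵢ[ℂ] H) (a : ℂ) (k : ℕ) (p : H × H) :
    szegoStep U a ((U ^ k) p.1, (U ^ k) p.2) =
      ((U ^ k) (szegoStep U a p).1, (U ^ k) (szegoStep U a p).2) := by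
  simp [szegoStep, map_pow_apply]

/-- Solving the block relations for the new vectors (`theta_apply_iff`) exhibits them as Szegő
steps: blocks of ℒ give the even steps, and blocks of ℳ, after applying `U`, the odd ones. -/
theorem isCMVPair_iff {U : H ≃ₗᵢ[ℂ] H} {α : ℕ → ℂ} (hα : ∀ n, ‖α n‖ < 1) {χ x : ℕ → H} :
    IsCMVPair U α χ x ↔ χ 0 = x 0 ∧
      (∀ k, (χ (2 * k + 1), U (x (2 * k + 1))) = szegoStep U (α (2 * k)) (x (2 * k), χ (2 * k))) ∧
      ∀ k, (U (x (2 * k + 2)), U (χ (2 * k + 2))) =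
        szegoStep U (α (2 * k + 1)) (χ (2 * k + 1), U (x (2 * k + 1))) := by
  have h1 : ∀ k, ((χ (2 * k + 1), U (x (2 * k + 1))) =
      szegoStep U (α (2 * k)) (x (2 * k), χ (2 * k)) ↔
      U (x (2 * k)) = rotate (fun k => α (2 * k)) χ (2 * k) ∧
      U (x (2 * k + 1)) = rotate (fun k => α (2 * k)) χ (2 * k + 1)) := by
    intro k
    rw [rotate_even, rotate_odd, theta_apply_iff (hα _), szegoStep, Prod.mk.injEq]
  have h2 : ∀ k, ((U (x (2 * k + 2)), U (χ (2 * k + 2))) =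
        szegoStep U (α (2 * k + 1)) (χ (2 * k + 1), U (x (2 * k + 1))) ↔
      χ (2 * k + 1) = rotateSucc (fun k => α (2 * k + 1)) x (2 * k + 1) ∧
      χ (2 * k + 2) = rotateSucc (fun k => α (2 * k + 1)) x (2 * k + 2)) := by
    intro k
    rw [rotateSucc, rotateSucc, rotate_even, rotate_odd, theta_apply_iff (hα _), szegoStep,
      Prod.mk.injEq, ← U.injective.eq_iff (a := x (2 * k + 1 + 1)),
      ← U.injective.eq_iff (a := χ (2 * k + 2))]
    simp
  simp only [h1, h2]
  constructor
  · rintro ⟨h3, h4⟩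
    exact ⟨h4 0, fun k => ⟨h3 _, h3 _⟩, fun k => ⟨h4 _, h4 _⟩⟩
  · rintro ⟨h0, h3, h4⟩
    refine ⟨fun n => ?_, fun n => ?_⟩
    · obtain ⟨k, rfl | rfl⟩ := Nat.even_or_odd' n
      exacts [(h3 k).1, (h3 k).2]
    · cases n with
      | zero => exact h0
      | succ n =>
        obtain ⟨k, rfl | rfl⟩ := Nat.even_or_odd' n
        exacts [(h4 k).1, (h4 k).2]

/-- The CMV basis of a model. -/
noncomputable def cmvBasis (U : H ≃ₗᵢ[ℂ] H) (v₀ : H) (n : ℕ) : H :=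
  if n % 2 = 0 then (U ^ (n / 2))⁻¹ (szego U v₀ n).2 else (U ^ (n / 2))⁻¹ (szego U v₀ n).1

/-- The alternate CMV basis of a model. -/
noncomputable def altBasis (U : H ≃ₗᵢ[ℂ] H) (v₀ : H) (n : ℕ) : H :=
  if n % 2 = 0 then (U ^ (n / 2))⁻¹ (szego U v₀ n).1
  else (U ^ (n / 2 + 1))⁻¹ (szego U v₀ n).2

theorem cmvBasis_even (U : H ≃ₗᵢ[ℂ] H) (v₀ : H) (k : ℕ) :
    cmvBasis U v₀ (2 * k) = (U ^ k)⁻¹ (szego U v₀ (2 * k)).2 := by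
  simp [cmvBasis]

theorem cmvBasis_odd (U : H ≃ₗᵢ[ℂ] H) (v₀ : H) (k : ℕ) :
    cmvBasis U v₀ (2 * k + 1) = (U ^ k)⁻¹ (szego U v₀ (2 * k + 1)).1 := by
  have h : (2 * k + 1) / 2 = k := by omega
  simp [cmvBasis, h, Nat.add_mod]

theorem altBasis_even (U : H ≃ₗᵢ[ℂ] H) (v₀ : H) (k : ℕ) :
    altBasis U v₀ (2 * k) = (U ^ k)⁻¹ (szego U v₀ (2 * k)).1 := by
  simp [altBasis]

theorem altBasis_odd (U : H ≃ₗᵢ[ℂ] H) (v₀ : H) (k : ℕ) :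
    U (altBasis U v₀ (2 * k + 1)) = (U ^ k)⁻¹ (szego U v₀ (2 * k + 1)).2 := by
  have h : (2 * k + 1) / 2 = k := by omega
  have h2 : (U ^ (k + 1))⁻¹ = U⁻¹ * (U ^ k)⁻¹ := by rw [pow_succ, mul_inv_rev]
  have h3 : (2 * k + 1) % 2 = 1 := by omega
  simp only [altBasis, h, h2, h3, one_ne_zero, if_false]
  exact U.apply_symm_apply _

theorem szegoStep_inv_pow (U : H ≃ₗᵢ[ℂ] H) (a : ℂ) (k : ℕ) (p : H × H) :
    szegoStep U a ((U ^ k)⁻¹ p.1, (U ^ k)⁻¹ p.2) =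
      ((U ^ k)⁻¹ (szegoStep U a p).1, (U ^ k)⁻¹ (szegoStep U a p).2) := by
  simp only [szegoStep, map_inv_pow_apply, map_sub, map_smul]

/-- A Szegő step commutes with powers of `U`, so the factors U⁻ᵏ pass through the recursion. -/
theorem isCMVPair_cmvBasis {U : H ≃ₗᵢ[ℂ] H} {v₀ : H} (h : ∀ n, ‖modelCoeff U v₀ n‖ < 1) :
    IsCMVPair U (modelCoeff U v₀) (cmvBasis U v₀) (altBasis U v₀) := by
  rw [isCMVPair_iff h]
  refine ⟨rfl, fun k => ?_, fun k => ?_⟩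
  · rw [cmvBasis_odd, altBasis_odd, cmvBasis_even, altBasis_even, szegoStep_inv_pow, szego_succ]
  · have h1 : ∀ y, U ((U ^ (k + 1))⁻¹ y) = (U ^ k)⁻¹ y := by
      intro y
      have h2 : (U ^ (k + 1))⁻¹ = U⁻¹ * (U ^ k)⁻¹ := by rw [pow_succ, mul_inv_rev]
      rw [h2]
      exact U.apply_symm_apply _
    rw [show 2 * k + 2 = 2 * (k + 1) by ring, cmvBasis_odd, altBasis_odd, cmvBasis_even,
      altBasis_even, h1, h1, szegoStep_inv_pow, show 2 * (k + 1) = 2 * k + 1 + 1 by ring,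
      szego_succ]

/-- Induction along the recursion, alternating between vectors and coefficients: a coefficient is
read off as the diagonal entry of a Θ block by orthonormality, and it then determines the next pair.
-/
theorem IsCMVPair.szego_eq {U : H ≃ₗᵢ[ℂ] H} {α : ℕ → ℂ} (hα : ∀ n, ‖α n‖ < 1) {χ x : ℕ → H}
    (h : IsCMVPair U α χ x) (hχ : Orthonormal ℂ χ) (k : ℕ) :
    szego U (χ 0) (2 * k) = ((U ^ k) (x (2 * k)), (U ^ k) (χ (2 * k))) ∧
      szego U (χ 0) (2 * k + 1) = ((U ^ k) (χ (2 * k + 1)), (U ^ k) (U (x (2 * k + 1)))) ∧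
      modelCoeff U (χ 0) (2 * k) = α (2 * k) ∧
      modelCoeff U (χ 0) (2 * k + 1) = α (2 * k + 1) := by
  have hx := h.orthonormal hα hχ
  obtain ⟨h0, hodd, heven⟩ := (isCMVPair_iff hα).1 h
  have hcodd : ∀ k, szego U (χ 0) (2 * k) = ((U ^ k) (x (2 * k)), (U ^ k) (χ (2 * k))) →
      modelCoeff U (χ 0) (2 * k) = α (2 * k) := by
    intro k hk
    rw [modelCoeff, hk, map_pow_apply, LinearIsometryEquiv.inner_map_map, h.map_eq, rotate_even]
    simp only [inner_add_left, inner_smul_left, orthonormal_iff_ite.1 hχ]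
    simp
  have hsodd : ∀ k, szego U (χ 0) (2 * k) = ((U ^ k) (x (2 * k)), (U ^ k) (χ (2 * k))) →
      szego U (χ 0) (2 * k + 1) = ((U ^ k) (χ (2 * k + 1)), (U ^ k) (U (x (2 * k + 1)))) := by
    intro k hk
    rw [szego_succ, hcodd k hk, hk, szegoStep_pow U (α (2 * k)) k (x (2 * k), χ (2 * k)), ← hodd]
  have hceven : ∀ k, szego U (χ 0) (2 * k + 1) =
      ((U ^ k) (χ (2 * k + 1)), (U ^ k) (U (x (2 * k + 1)))) →
      modelCoeff U (χ 0) (2 * k + 1) = α (2 * k + 1) := by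
    intro k hk
    rw [modelCoeff, hk, map_pow_apply, LinearIsometryEquiv.inner_map_map,
      LinearIsometryEquiv.inner_map_map, h.eq_rotateSucc, rotateSucc, rotate_even]
    simp only [inner_add_left, inner_smul_left, orthonormal_iff_ite.1 hx]
    simp
  have hseven : ∀ k, szego U (χ 0) (2 * k + 1) =
      ((U ^ k) (χ (2 * k + 1)), (U ^ k) (U (x (2 * k + 1)))) →
      szego U (χ 0) (2 * (k + 1)) =
        ((U ^ (k + 1)) (x (2 * (k + 1))), (U ^ (k + 1)) (χ (2 * (k + 1)))) := by
    intro k hk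
    rw [show 2 * (k + 1) = 2 * k + 1 + 1 by ring, szego_succ, hceven k hk, hk,
      szegoStep_pow U (α (2 * k + 1)) k (χ (2 * k + 1), U (x (2 * k + 1))), ← heven, pow_succ]
    rfl
  have key : szego U (χ 0) (2 * k) = ((U ^ k) (x (2 * k)), (U ^ k) (χ (2 * k))) := by
    induction k with
    | zero => simp [szego, h0]
    | succ k ih => exact hseven k (hsodd k ih)
  exact ⟨key, hsodd k key, hcodd k key, hceven k (hsodd k key)⟩

theorem IsCMVPair.modelCoeff_eq {U : H ≃ₗᵢ[ℂ] H} {α : ℕ → ℂ} (hα : ∀ n, ‖α n‖ < 1) {χ x : ℕ → H}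
    (h : IsCMVPair U α χ x) (hχ : Orthonormal ℂ χ) : modelCoeff U (χ 0) = α := by
  funext n
  obtain ⟨k, rfl | rfl⟩ := Nat.even_or_odd' n
  exacts [(h.szego_eq hα hχ k).2.2.1, (h.szego_eq hα hχ k).2.2.2]

/-- The whole family is recovered from `U` and `χ 0` alone; for χ = δ this gives cyclicity of δ₀. -/
theorem IsCMVPair.cmvBasis_eq {U : H ≃ₗᵢ[ℂ] H} {α : ℕ → ℂ} (hα : ∀ n, ‖α n‖ < 1) {χ x : ℕ → H}
    (h : IsCMVPair U α χ x) (hχ : Orthonormal ℂ χ) : cmvBasis U (χ 0) = χ := by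
  funext n
  obtain ⟨k, rfl | rfl⟩ := Nat.even_or_odd' n
  · rw [cmvBasis_even, (h.szego_eq hα hχ k).1]
    exact (U ^ k).symm_apply_apply _
  · rw [cmvBasis_odd, (h.szego_eq hα hχ k).2.1]
    exact (U ^ k).symm_apply_apply _

/-! ### Membership in the span of the orbit -/

theorem map_zpow_mem_span (U : H ≃ₗᵢ[ℂ] H) (v₀ : H) (m : ℤ) {y : H}
    (hy : y ∈ Submodule.span ℂ (Set.range fun n : ℤ => (U ^ n) v₀)) :
    (U ^ m) y ∈ Submodule.span ℂ (Set.range fun n : ℤ => (U ^ n) v₀) := by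
  have h : Submodule.span ℂ (Set.range fun n : ℤ => (U ^ n) v₀) ≤
      (Submodule.span ℂ (Set.range fun n : ℤ => (U ^ n) v₀)).comap
        ((U ^ m).toLinearEquiv : H →ₗ[ℂ] H) := by
    rw [Submodule.span_le]
    rintro _ ⟨n, rfl⟩
    refine Submodule.subset_span ⟨m + n, ?_⟩
    simp only [zpow_add]
    rfl
  exact h hy

theorem szego_mem_span (U : H ≃ₗᵢ[ℂ] H) (v₀ : H) (n : ℕ) :
    (szego U v₀ n).1 ∈ Submodule.span ℂ (Set.range fun n : ℤ => (U ^ n) v₀) ∧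
      (szego U v₀ n).2 ∈ Submodule.span ℂ (Set.range fun n : ℤ => (U ^ n) v₀) := by
  induction n with
  | zero =>
    have : v₀ ∈ Submodule.span ℂ (Set.range fun n : ℤ => (U ^ n) v₀) :=
      Submodule.subset_span ⟨0, by simp⟩
    exact ⟨this, this⟩
  | succ n ih =>
    have h1 : U (szego U v₀ n).1 ∈ Submodule.span ℂ (Set.range fun n : ℤ => (U ^ n) v₀) := by
      simpa using map_zpow_mem_span U v₀ 1 ih.1
    rw [szego_succ]
    exact ⟨Submodule.smul_mem _ _ (sub_mem h1 (Submodule.smul_mem _ _ ih.2)),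
      Submodule.smul_mem _ _ (sub_mem ih.2 (Submodule.smul_mem _ _ h1))⟩

theorem cmvBasis_mem_span (U : H ≃ₗᵢ[ℂ] H) (v₀ : H) (n : ℕ) :
    cmvBasis U v₀ n ∈ Submodule.span ℂ (Set.range fun n : ℤ => (U ^ n) v₀) := by
  have h : ∀ (k : ℕ) (y : H), (U ^ k)⁻¹ y = (U ^ (-k : ℤ)) y := fun k y => by simp
  rw [cmvBasis]
  split_ifs
  · rw [h]
    exact map_zpow_mem_span U v₀ _ (szego_mem_span U v₀ n).2
  · rw [h]
    exact map_zpow_mem_span U v₀ _ (szego_mem_span U v₀ n).1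

end Szego

theorem IsProperCMV.isProperCyclicUnitaryModel {C : ell2 ≃ₗᵢ[ℂ] ell2} (hC : IsProperCMV C) :
    IsProperCyclicUnitaryModel C (delta 0) := by
  obtain ⟨α, hα, hm⟩ := hC
  obtain ⟨x, hx⟩ := (hasMatrix_matC_iff hα).1 hm
  refine ⟨⟨orthonormal_delta.1 0, ?_⟩, fun hfin => ?_⟩
  · refine ((Submodule.dense_iff_topologicalClosure_eq_top).2 dense_span_delta).mono ?_
    rw [SetLike.coe_subset_coe, Submodule.span_le]
    rintro _ ⟨n, rfl⟩
    have h := cmvBasis_mem_span C (delta 0) n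
    rwa [hx.cmvBasis_eq hα orthonormal_delta] at h
  · exact Infinite.not_finite (α := ℕ) (orthonormal_delta.linearIndependent.finite)

/-- The coefficients at δ₀ are the CMV parameters, these fix the matrix, and the matrix fixes the
operator. -/
theorem IsProperCMV.eq_of_modelCoeff_eq {C C' : ell2 ≃ₗᵢ[ℂ] ell2} (hC : IsProperCMV C)
    (hC' : IsProperCMV C') (h : modelCoeff C (delta 0) = modelCoeff C' (delta 0)) : C = C' := by
  obtain ⟨α, hα, hm⟩ := hC
  obtain ⟨x, hx⟩ := (hasMatrix_matC_iff hα).1 hm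
  obtain ⟨α', hα', hm'⟩ := hC'
  obtain ⟨x', hx'⟩ := (hasMatrix_matC_iff hα').1 hm'
  rw [hx.modelCoeff_eq hα orthonormal_delta, hx'.modelCoeff_eq hα' orthonormal_delta] at h
  subst h
  exact hm.unique hm'

/-! ### Szegő polynomials -/

open Polynomial in
/-- The Szegő polynomials `(φₙ, φₙ*)` with coefficients `α`. -/
noncomputable def szegoPoly (α : ℕ → ℂ) : ℕ → ℂ[X] × ℂ[X]
  | 0 => (1, 1)
  | n + 1 =>
    (C (rho (α n) : ℂ)⁻¹ * (X * (szegoPoly α n).1 - C (conj (α n)) * (szegoPoly α n).2),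
      C (rho (α n) : ℂ)⁻¹ * ((szegoPoly α n).2 - C (α n) * (X * (szegoPoly α n).1)))

theorem coeff_szegoPoly_of_lt (α : ℕ → ℂ) {n j : ℕ} (h : n < j) :
    (szegoPoly α n).1.coeff j = 0 ∧ (szegoPoly α n).2.coeff j = 0 := by
  induction n generalizing j with
  | zero => simp [szegoPoly, Polynomial.coeff_one, h.ne']
  | succ n ih =>
    obtain ⟨j, rfl⟩ : ∃ i, j = i + 1 := ⟨j - 1, by omega⟩
    have h1 := ih (show n < j by omega)
    have h2 := ih (show n < j + 1 by omega)
    simp [szegoPoly, Polynomial.coeff_X_mul, h1.1, h2.2]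

/-- Conjugate reversal in degree n + 1 exchanges zφₙ and φₙ*, hence exchanges the two lines of the
recursion. -/
theorem coeff_szegoPoly_snd (α : ℕ → ℂ) {n j : ℕ} (h : j ≤ n) :
    (szegoPoly α n).2.coeff j = conj ((szegoPoly α n).1.coeff (n - j)) := by
  induction n generalizing j with
  | zero =>
    obtain rfl : j = 0 := by omega
    simp [szegoPoly]
  | succ n ih =>
    have h0 := ih (Nat.zero_le n)
    have hn := (coeff_szegoPoly_of_lt α (Nat.lt_succ_self n)).2
    have ih' : ∀ j ≤ n, (szegoPoly α n).1.coeff (n - j) = conj ((szegoPoly α n).2.coeff j) := by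
      intro j hj
      rw [ih hj, RCLike.conj_conj]
    rcases Nat.eq_zero_or_pos j with rfl | hj
    · simp [szegoPoly, Polynomial.coeff_X_mul, h0, hn]
    · obtain ⟨j, rfl⟩ : ∃ i, j = i + 1 := ⟨j - 1, by omega⟩
      rcases Nat.eq_or_lt_of_le h with h | h
      · obtain rfl : j = n := by omega
        simp [szegoPoly, Polynomial.coeff_X_mul, h0, hn]
      · have e : n + 1 - (j + 1) = (n - (j + 1)) + 1 := by omega
        have e2 : n - (j + 1) + 1 = n - j := by omega
        have h3 := ih (show n - j ≤ n by omega)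
        rw [Nat.sub_sub_self (by omega)] at h3
        rw [← e2] at h3
        rw [e]
        simp [szegoPoly, Polynomial.coeff_X_mul, ih (show j + 1 ≤ n by omega), h3]

/-- Each step multiplies the leading coefficient by 1/ρ, since φₙ* has degree at most n. Only
earlier coefficients are constrained, so the lemma is available in the induction that puts the next
one in the disk. -/
theorem coeff_szegoPoly_fst_self {α : ℕ → ℂ} {n : ℕ} (h : ∀ k < n, ‖α k‖ < 1) :
    ∃ κ : ℝ, 0 < κ ∧ (szegoPoly α n).1.coeff n = (κ : ℂ) := by
  induction n with
  | zero => exact ⟨1, one_pos, by simp [szegoPoly]⟩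
  | succ n ih =>
    obtain ⟨κ, hκ, h1⟩ := ih fun k hk => h k (by omega)
    refine ⟨(rho (α n))⁻¹ * κ, mul_pos (inv_pos.2 (rho_pos (h n (by omega)))) hκ, ?_⟩
    simp [szegoPoly, Polynomial.coeff_X_mul, h1,
      (coeff_szegoPoly_of_lt α (Nat.lt_succ_self n)).2]

theorem natDegree_szegoPoly_fst_le (α : ℕ → ℂ) (n : ℕ) : (szegoPoly α n).1.natDegree ≤ n :=
  Polynomial.natDegree_le_iff_coeff_eq_zero.2 fun _ h => (coeff_szegoPoly_of_lt α h).1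

theorem natDegree_szegoPoly_snd_le (α : ℕ → ℂ) (n : ℕ) : (szegoPoly α n).2.natDegree ≤ n :=
  Polynomial.natDegree_le_iff_coeff_eq_zero.2 fun _ h => (coeff_szegoPoly_of_lt α h).2

theorem natDegree_szegoPoly_fst {α : ℕ → ℂ} (h : ∀ k, ‖α k‖ < 1) (n : ℕ) :
    (szegoPoly α n).1.natDegree = n := by
  obtain ⟨κ, hκ, h1⟩ := coeff_szegoPoly_fst_self (n := n) fun k _ => h k
  refine le_antisymm (natDegree_szegoPoly_fst_le α n) (Polynomial.le_natDegree_of_ne_zero ?_)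
  rw [h1]
  exact_mod_cast hκ.ne'

theorem szegoDual_szegoPoly (α : ℕ → ℂ) (n : ℕ) :
    szegoDual n (szegoPoly α n).1 = (szegoPoly α n).2 := by
  ext j
  rw [szegoDual, Polynomial.finsetSum_coeff]
  simp only [Polynomial.coeff_monomial]
  rw [Finset.sum_ite_eq']
  split_ifs with h
  · exact (coeff_szegoPoly_snd α (by simpa [Nat.lt_succ_iff] using h)).symm
  · exact (coeff_szegoPoly_of_lt α (by simpa using h)).2.symm

theorem szegoPoly_recursion {α : ℕ → ℂ} (h : ∀ k, ‖α k‖ < 1) (n : ℕ) :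
    Polynomial.C (rho (α n) : ℂ) * (szegoPoly α (n + 1)).1 =
      Polynomial.X * (szegoPoly α n).1 -
        Polynomial.C (conj (α n)) * szegoDual n (szegoPoly α n).1 := by
  rw [szegoDual_szegoPoly, szegoPoly, ← mul_assoc, ← Polynomial.C_mul,
    mul_inv_cancel₀ (rho_ne_zero (h n)), Polynomial.C_1, one_mul]

/-! ### Polynomials in `U` applied to `v₀`, and the CMV basis of a proper model -/

section Orbit

variable {H : Type*} [NormedAddCommGroup H] [InnerProductSpace ℂ H]

/-- The vector `P(U) v₀`. -/
noncomputable def polyOrbit (U : H ≃ₗᵢ[ℂ] H) (v₀ : H) : Polynomial ℂ →ₗ[ℂ] H :=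
  (ContinuousLinearMap.apply ℂ H v₀ : (H →L[ℂ] H) →ₗ[ℂ] H) ∘ₗ
    (Polynomial.aeval (U : H →L[ℂ] H)).toLinearMap

theorem polyOrbit_apply (U : H ≃ₗᵢ[ℂ] H) (v₀ : H) (P : Polynomial ℂ) :
    polyOrbit U v₀ P = Polynomial.aeval (U : H →L[ℂ] H) P v₀ := rfl

theorem polyOrbit_mul (U : H ≃ₗᵢ[ℂ] H) (v₀ : H) (P Q : Polynomial ℂ) :
    polyOrbit U v₀ (P * Q) = Polynomial.aeval (U : H →L[ℂ] H) P (polyOrbit U v₀ Q) := by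
  rw [polyOrbit_apply, map_mul, polyOrbit_apply]
  rfl

theorem polyOrbit_C_mul (U : H ≃ₗᵢ[ℂ] H) (v₀ : H) (a : ℂ) (Q : Polynomial ℂ) :
    polyOrbit U v₀ (Polynomial.C a * Q) = a • polyOrbit U v₀ Q := by
  rw [← Polynomial.smul_eq_C_mul, map_smul]

theorem polyOrbit_X_mul (U : H ≃ₗᵢ[ℂ] H) (v₀ : H) (Q : Polynomial ℂ) :
    polyOrbit U v₀ (Polynomial.X * Q) = U (polyOrbit U v₀ Q) := by
  rw [polyOrbit_mul, Polynomial.aeval_X]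
  rfl

theorem polyOrbit_X_pow_mul (U : H ≃ₗᵢ[ℂ] H) (v₀ : H) (n : ℕ) (Q : Polynomial ℂ) :
    polyOrbit U v₀ (Polynomial.X ^ n * Q) = (U ^ n) (polyOrbit U v₀ Q) := by
  induction n with
  | zero => simp
  | succ n ih =>
    rw [pow_succ', mul_assoc, polyOrbit_X_mul, ih, pow_succ']
    rfl

theorem polyOrbit_one (U : H ≃ₗᵢ[ℂ] H) (v₀ : H) : polyOrbit U v₀ 1 = v₀ := by
  simp [polyOrbit_apply]

theorem polyOrbit_X_pow (U : H ≃ₗᵢ[ℂ] H) (v₀ : H) (n : ℕ) :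
    polyOrbit U v₀ (Polynomial.X ^ n) = (U ^ n) v₀ := by
  have := polyOrbit_X_pow_mul U v₀ n 1
  rwa [mul_one, polyOrbit_one] at this

theorem polyOrbit_eq_sum (U : H ≃ₗᵢ[ℂ] H) (v₀ : H) {P : Polynomial ℂ} {n : ℕ}
    (h : P.natDegree < n) :
    polyOrbit U v₀ P = ∑ i ∈ Finset.range n, P.coeff i • (U ^ i) v₀ := by
  conv_lhs => rw [Polynomial.as_sum_range' P n h]
  rw [map_sum]
  refine Finset.sum_congr rfl fun i _ => ?_
  rw [← Polynomial.C_mul_X_pow_eq_monomial, polyOrbit_C_mul, polyOrbit_X_pow]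

theorem szego_eq_polyOrbit (U : H ≃ₗᵢ[ℂ] H) (v₀ : H) (n : ℕ) :
    szego U v₀ n = (polyOrbit U v₀ (szegoPoly (modelCoeff U v₀) n).1,
      polyOrbit U v₀ (szegoPoly (modelCoeff U v₀) n).2) := by
  induction n with
  | zero => simp [szego, szegoPoly, polyOrbit_one]
  | succ n ih =>
    rw [szego_succ, ih]
    simp only [szegoStep, szegoPoly, polyOrbit_C_mul, polyOrbit_X_mul, map_sub]

theorem szego_fst (U : H ≃ₗᵢ[ℂ] H) (v₀ : H) (n : ℕ) :
    (szego U v₀ n).1 = polyOrbit U v₀ (szegoPoly (modelCoeff U v₀) n).1 :=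
  congrArg Prod.fst (szego_eq_polyOrbit U v₀ n)

theorem szego_snd (U : H ≃ₗᵢ[ℂ] H) (v₀ : H) (n : ℕ) :
    (szego U v₀ n).2 = polyOrbit U v₀ (szegoPoly (modelCoeff U v₀) n).2 :=
  congrArg Prod.snd (szego_eq_polyOrbit U v₀ n)

/-- Inner products of `U φ - ᾱ ψ` and `ψ - α U φ` for unit vectors with `α = ⟪U φ, ψ⟫`. -/
theorem inner_szego_succ_aux {φ ψ : H} (U : H ≃ₗᵢ[ℂ] H) (hφ : inner ℂ φ φ = 1)
    (hψ : inner ℂ ψ ψ = 1) {a : ℂ} (ha : a = inner ℂ (U φ) ψ) :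
    inner ℂ ψ (U φ - conj a • ψ) = 0 ∧ inner ℂ (U φ) (ψ - a • U φ) = 0 ∧
      inner ℂ (U φ - conj a • ψ) (U φ - conj a • ψ) = 1 - a * conj a ∧
      inner ℂ (ψ - a • U φ) (ψ - a • U φ) = 1 - a * conj a := by
  have ha' : inner ℂ ψ (U φ) = conj a := by rw [ha, inner_conj_symm]
  have hU : inner ℂ (U φ) (U φ) = 1 := by rw [LinearIsometryEquiv.inner_map_map, hφ]
  simp only [inner_sub_left, inner_sub_right, inner_smul_left, inner_smul_right, ha', hU, hψ, ← ha,
    RCLike.conj_conj]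
  refine ⟨by ring, by ring, by ring, by ring⟩

/-- The vectors `φₙ` and `φₙ*` are unit vectors, `φₙ` is orthogonal to `v₀, …, Uⁿ⁻¹ v₀`, and
`φₙ*` to `U v₀, …, Uⁿ v₀`. -/
theorem szego_orthogonal {U : H ≃ₗᵢ[ℂ] H} {v₀ : H} (hv : ‖v₀‖ = 1) {n : ℕ}
    (h : ∀ k < n, ‖modelCoeff U v₀ k‖ < 1) :
    inner ℂ (szego U v₀ n).1 (szego U v₀ n).1 = (1 : ℂ) ∧
      inner ℂ (szego U v₀ n).2 (szego U v₀ n).2 = (1 : ℂ) ∧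
      (∀ j < n, inner ℂ ((U ^ j) v₀) (szego U v₀ n).1 = (0 : ℂ)) ∧
      ∀ j < n, inner ℂ ((U ^ (j + 1)) v₀) (szego U v₀ n).2 = (0 : ℂ) := by
  induction n with
  | zero => simp [szego, inner_self_eq_norm_sq_to_K, hv]
  | succ n ih =>
    have hlt : ∀ k < n, ‖modelCoeff U v₀ k‖ < 1 := fun k hk => h k (by omega)
    obtain ⟨h1, h2, h3, h4⟩ := ih hlt
    obtain ⟨κ, hκ, hκ'⟩ := coeff_szegoPoly_fst_self hlt
    have hκ0 : (κ : ℂ) ≠ 0 := by exact_mod_cast hκ.ne'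
    obtain ⟨h5, h6, h7, h8⟩ := inner_szego_succ_aux U h1 h2 (a := modelCoeff U v₀ n) rfl
    have hr := rho_mul_self (h n (by omega)).le
    have hr0 := rho_ne_zero (h n (by omega))
    set a := modelCoeff U v₀ n with ha
    set φ := (szego U v₀ n).1 with hφ
    set ψ := (szego U v₀ n).2 with hψ
    have hφU : ∀ j < n, inner ℂ ((U ^ (j + 1)) v₀) (U φ) = 0 := by
      intro j hj
      rw [pow_succ', ← h3 j hj]
      exact U.inner_map_map _ _
    have hnorm : ∀ w : H, inner ℂ w w = 1 - a * conj a →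
        inner ℂ ((rho a : ℂ)⁻¹ • w) ((rho a : ℂ)⁻¹ • w) = (1 : ℂ) := by
      intro w hw
      rw [inner_smul_left, inner_smul_right, hw, ← hr, map_inv₀, Complex.conj_ofReal]
      field_simp
    rw [szego_succ, szegoStep]
    refine ⟨hnorm _ h7, hnorm _ h8, fun j hj => ?_, fun j hj => ?_⟩
    · rw [inner_smul_right]
      refine mul_eq_zero_of_right _ ?_
      cases j with
      | succ j =>
        rw [inner_sub_right, inner_smul_right, hφU j (by omega), h4 j (by omega)]
        simp
      | zero =>
        -- The new vector is orthogonal to φₙ* and to U v₀, …, Uⁿ v₀. The constant term of φₙ* is κ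
        -- ≠ 0, so orthogonality to `v₀` follows.
        have e : ψ = _ := szego_snd U v₀ n
        rw [polyOrbit_eq_sum U v₀ (Nat.lt_succ_of_le (natDegree_szegoPoly_snd_le _ n)),
          Finset.sum_range_succ'] at e
        nth_rewrite 1 [e] at h5
        rw [inner_add_left, sum_inner, Finset.sum_eq_zero, zero_add, inner_smul_left,
          coeff_szegoPoly_snd _ (Nat.zero_le n), Nat.sub_zero, hκ', Complex.conj_ofReal,
          Complex.conj_ofReal] at h5
        · exact (mul_eq_zero.1 h5).resolve_left hκ0
        · intro i hi
          rw [inner_smul_left, inner_sub_right, inner_smul_right,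
            hφU i (Finset.mem_range.1 hi), h4 i (Finset.mem_range.1 hi)]
          simp
    · rw [inner_smul_right]
      refine mul_eq_zero_of_right _ ?_
      rcases Nat.lt_or_eq_of_le (Nat.lt_succ_iff.1 hj) with hj | rfl
      · rw [inner_sub_right, inner_smul_right, hφU j hj, h4 j hj]
        simp
      · have e : φ = _ := szego_fst U v₀ j
        rw [polyOrbit_eq_sum U v₀ (Nat.lt_succ_of_le (natDegree_szegoPoly_fst_le _ j)),
          Finset.sum_range_succ] at e
        nth_rewrite 1 [e] at h6
        have hU : ∀ i, U ((U ^ i) v₀) = (U ^ (i + 1)) v₀ := fun i => by rw [pow_succ']; rfl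
        simp only [map_add, map_sum, map_smul, hU] at h6
        rw [inner_add_left, sum_inner, Finset.sum_eq_zero, zero_add, inner_smul_left, hκ',
          Complex.conj_ofReal] at h6
        · exact (mul_eq_zero.1 h6).resolve_left hκ0
        · intro i hi
          rw [inner_smul_left, inner_sub_right, inner_smul_right,
            hφU i (Finset.mem_range.1 hi), h4 i (Finset.mem_range.1 hi)]
          simp

/-- A cyclic model in which `v₀` is annihilated by a nonzero polynomial in `U` is
finite-dimensional. -/
theorem IsCyclicUnitaryModel.finiteDimensional {U : H ≃ₗᵢ[ℂ] H} {v₀ : H}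
    (h : IsCyclicUnitaryModel U v₀) {Q : Polynomial ℂ} (hQ : Q ≠ 0) (h0 : polyOrbit U v₀ Q = 0) :
    FiniteDimensional ℂ H := by
  set S := LinearMap.range (polyOrbit U v₀) with hS
  have hfin : FiniteDimensional ℂ S := by
    -- Modulo `Q`, every P(U)v₀ equals R(U)v₀ with R the remainder of P.
    have hle : S ≤ Submodule.span ℂ
        ((fun i => (U ^ i) v₀) '' (Finset.range (Q.natDegree + 1) : Set ℕ)) := by
      rintro _ ⟨P, rfl⟩
      have hdeg : (P % Q).natDegree < Q.natDegree + 1 :=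
        Nat.lt_succ_of_le (Polynomial.natDegree_le_natDegree (Polynomial.degree_mod_lt P hQ).le)
      rw [← EuclideanDomain.div_add_mod P Q, mul_comm, map_add, polyOrbit_mul, h0, map_zero,
        zero_add, polyOrbit_eq_sum U v₀ hdeg]
      exact Submodule.sum_mem _ fun i hi =>
        Submodule.smul_mem _ _ (Submodule.subset_span ⟨i, hi, rfl⟩)
    have := FiniteDimensional.span_of_finite ℂ
      ((Finset.range (Q.natDegree + 1)).finite_toSet.image fun i => (U ^ i) v₀)
    exact Submodule.finiteDimensional_of_le hle
  -- An injective map of a finite-dimensional space into itself is onto, so `S` also absorbs U⁻¹.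
  have hmap : S.map (U.toLinearEquiv : H →ₗ[ℂ] H) = S := by
    refine Submodule.eq_of_le_of_finrank_eq ?_ (LinearEquiv.finrank_map_eq U.toLinearEquiv S)
    rintro _ ⟨_, ⟨P, rfl⟩, rfl⟩
    exact ⟨Polynomial.X * P, polyOrbit_X_mul U v₀ P⟩
  have hle : Submodule.span ℂ (Set.range fun n : ℤ => (U ^ n) v₀) ≤ S := by
    rw [Submodule.span_le]
    rintro _ ⟨n, rfl⟩
    exact zpow_mem_of_map_eq hmap ⟨1, polyOrbit_one U v₀⟩ n
  have htop : S = ⊤ := by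
    have hd : Dense (S : Set H) := h.cyclic.mono hle
    have hc : IsClosed (S : Set H) := S.closed_of_finiteDimensional
    exact SetLike.coe_injective (by simpa [hc.closure_eq] using hd.closure_eq)
  rw [htop] at hfin
  exact Module.Finite.of_surjective _ (Submodule.topEquiv (R := ℂ) (M := H)).surjective

/-- The Verblunsky coefficients of a proper model belong to the unit disk. -/
theorem IsProperCyclicUnitaryModel.norm_modelCoeff_lt_one {U : H ≃ₗᵢ[ℂ] H} {v₀ : H}
    (h : IsProperCyclicUnitaryModel U v₀) (n : ℕ) : ‖modelCoeff U v₀ n‖ < 1 := by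
  -- The unit norms of φₙ, φₙ* and the positivity of κ need all earlier coefficients in the disk:
  -- outside it `rho` is 0 and the recursion takes junk values.
  induction n using Nat.strong_induction_on with
  | _ n ih =>
    by_contra hn
    obtain ⟨h1, h2, -, -⟩ := szego_orthogonal h.norm_eq_one ih
    have h3 := (inner_szego_succ_aux U h1 h2 (a := modelCoeff U v₀ n) rfl).2.2.1
    rw [inner_self_eq_norm_sq_to_K, Complex.mul_conj, Complex.normSq_eq_norm_sq] at h3
    have h4 : ‖U (szego U v₀ n).1 - conj (modelCoeff U v₀ n) • (szego U v₀ n).2‖ ^ 2 =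
        1 - ‖modelCoeff U v₀ n‖ ^ 2 := Complex.ofReal_injective (by simpa using h3)
    have h5 : U (szego U v₀ n).1 - conj (modelCoeff U v₀ n) • (szego U v₀ n).2 = 0 := by
      rw [← norm_eq_zero, ← sq_eq_zero_iff]
      exact le_antisymm (by rw [h4]; nlinarith) (sq_nonneg _)
    rw [szego_eq_polyOrbit] at h5
    simp only [← polyOrbit_X_mul, ← polyOrbit_C_mul, ← map_sub] at h5
    refine h.infinite_dimensional (h.finiteDimensional (fun hQ => ?_) h5)
    -- The annihilating polynomial zφₙ − conj(αₙ) φₙ* is nonzero, its coefficient in degree n + 1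
    -- being κ.
    obtain ⟨κ, hκ, hκ'⟩ := coeff_szegoPoly_fst_self ih
    have h6 := congrArg (fun P => Polynomial.coeff P (n + 1)) hQ
    simp only [Polynomial.coeff_sub, Polynomial.coeff_X_mul, hκ', Polynomial.coeff_C_mul,
      (coeff_szegoPoly_of_lt _ (Nat.lt_succ_self n)).2, Polynomial.coeff_zero, mul_zero,
      sub_zero] at h6
    exact hκ.ne' (by exact_mod_cast h6)

theorem inner_polyOrbit_szego {U : H ≃ₗᵢ[ℂ] H} {v₀ : H} (hv : ‖v₀‖ = 1)
    (h : ∀ k, ‖modelCoeff U v₀ k‖ < 1) {P : Polynomial ℂ} {i m n : ℕ} (hP : P.natDegree ≤ m) :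
    (i + m < n → inner ℂ ((U ^ i) (polyOrbit U v₀ P)) (szego U v₀ n).1 = (0 : ℂ)) ∧
      (0 < i → i + m ≤ n → inner ℂ ((U ^ i) (polyOrbit U v₀ P)) (szego U v₀ n).2 = (0 : ℂ)) := by
  obtain ⟨-, -, h3, h4⟩ := szego_orthogonal hv (n := n) fun k _ => h k
  have hU : ∀ j, (U ^ i) ((U ^ j) v₀) = (U ^ (i + j)) v₀ := fun j => by rw [pow_add]; rfl
  rw [polyOrbit_eq_sum U v₀ (Nat.lt_succ_of_le hP)]
  simp only [map_sum, map_smul, hU, sum_inner, inner_smul_left]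
  constructor
  · intro hi
    refine Finset.sum_eq_zero fun j hj => ?_
    rw [Finset.mem_range] at hj
    rw [h3 _ (by omega), mul_zero]
  · intro hi0 hi
    refine Finset.sum_eq_zero fun j hj => ?_
    rw [Finset.mem_range] at hj
    rw [show i + j = (i + j - 1) + 1 by omega, h4 _ (by omega), mul_zero]

theorem inner_inv_pow (U : H ≃ₗᵢ[ℂ] H) {l k : ℕ} (h : l ≤ k) (y z : H) :
    inner ℂ ((U ^ l)⁻¹ y) ((U ^ k)⁻¹ z) = inner ℂ ((U ^ (k - l)) y) z := by
  have h1 : U ^ k * (U ^ l)⁻¹ = U ^ (k - l) := (pow_sub U h).symm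
  have h2 : (U ^ k) ((U ^ k)⁻¹ z) = z := (U ^ k).apply_symm_apply z
  rw [← LinearIsometryEquiv.inner_map_map (U ^ k), h2, ← h1]
  rfl

/-- For m < n, cancelling the powers of `U` leaves an inner product of φₙ or φₙ* with a combination
of vectors Uʲv₀. The exponents j lie in [0, n − 1] when n is odd and in [1, n] when n is even,
exactly where φₙ, respectively φₙ*, is orthogonal. -/
theorem orthonormal_cmvBasis {U : H ≃ₗᵢ[ℂ] H} {v₀ : H} (hv : ‖v₀‖ = 1)
    (h : ∀ k, ‖modelCoeff U v₀ k‖ < 1) : Orthonormal ℂ (cmvBasis U v₀) := by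
  have hlt : ∀ m n, m < n → inner ℂ (cmvBasis U v₀ m) (cmvBasis U v₀ n) = (0 : ℂ) := by
    intro m n hmn
    have e1 : (szego U v₀ m).1 = _ := szego_fst U v₀ m
    have e2 : (szego U v₀ m).2 = _ := szego_snd U v₀ m
    have d1 := natDegree_szegoPoly_fst_le (modelCoeff U v₀) m
    have d2 := natDegree_szegoPoly_snd_le (modelCoeff U v₀) m
    obtain ⟨k, rfl | rfl⟩ := Nat.even_or_odd' n <;> obtain ⟨l, rfl | rfl⟩ := Nat.even_or_odd' m
    · rw [cmvBasis_even, cmvBasis_even, inner_inv_pow U (by omega), e2]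
      exact (inner_polyOrbit_szego hv h d2).2 (by omega) (by omega)
    · rw [cmvBasis_odd, cmvBasis_even, inner_inv_pow U (by omega), e1]
      exact (inner_polyOrbit_szego hv h d1).2 (by omega) (by omega)
    · rw [cmvBasis_even, cmvBasis_odd, inner_inv_pow U (by omega), e2]
      exact (inner_polyOrbit_szego hv h d2).1 (by omega)
    · rw [cmvBasis_odd, cmvBasis_odd, inner_inv_pow U (by omega), e1]
      exact (inner_polyOrbit_szego hv h d1).1 (by omega)
  have hnorm : ∀ y : H, inner ℂ y y = (1 : ℂ) → ‖y‖ = 1 := by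
    intro y hy
    rw [inner_self_eq_norm_sq_to_K] at hy
    have hy' : ‖y‖ ^ 2 = 1 := Complex.ofReal_injective (by simpa using hy)
    exact (pow_eq_one_iff_of_nonneg (norm_nonneg y) two_ne_zero).1 hy'
  refine ⟨fun n => ?_, fun m n hmn => ?_⟩
  · obtain ⟨h1, h2, -, -⟩ := szego_orthogonal hv (n := n) fun k _ => h k
    rw [cmvBasis]
    split_ifs
    · rw [LinearIsometryEquiv.norm_map]
      exact hnorm _ h2
    · rw [LinearIsometryEquiv.norm_map]
      exact hnorm _ h1
  · rcases lt_or_gt_of_ne hmn with h' | h'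
    · exact hlt m n h'
    · exact inner_eq_zero_symm.1 (hlt n m h')

/-- Every proper cyclic unitary model is equivalent to a proper CMV model. -/
theorem IsProperCyclicUnitaryModel.exists_isProperCMV [CompleteSpace H] {U : H ≃ₗᵢ[ℂ] H} {v₀ : H}
    (h : IsProperCyclicUnitaryModel U v₀) :
    ∃ C : ell2 ≃ₗᵢ[ℂ] ell2, IsProperCMV C ∧ ModelEquiv U v₀ C (delta 0) := by
  have hα := h.norm_modelCoeff_lt_one
  have hχ := orthonormal_cmvBasis h.norm_eq_one hα
  have hpair := isCMVPair_cmvBasis hα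
  have h0 : cmvBasis U v₀ 0 = v₀ := by simp [cmvBasis, szego]
  have hspan : ⊤ ≤ (Submodule.span ℂ (Set.range (cmvBasis U v₀))).topologicalClosure := by
    rw [← Submodule.dense_iff_topologicalClosure_eq_top.1 h.cyclic]
    apply Submodule.topologicalClosure_mono
    rw [Submodule.span_le]
    rintro _ ⟨n, rfl⟩
    have := hpair.zpow_mem_span hα n
    rwa [h0] at this
  set b := HilbertBasis.mk hχ hspan with hb
  have hbχ : ∀ n, b n = cmvBasis U v₀ n := fun n => by rw [hb, HilbertBasis.coe_mk]
  have hself : ∀ n, b.repr (cmvBasis U v₀ n) = delta n := by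
    intro n
    rw [← hbχ]
    exact b.repr_self n
  refine ⟨b.repr.symm.trans (U.trans b.repr), ⟨modelCoeff U v₀, hα, fun m k => ?_⟩,
    b.repr, by rw [← hself, h0], fun y => rfl⟩
  rw [← hself, ← hpair.inner_map hχ]
  simp [HilbertBasis.repr_apply_apply, hbχ]

end Orbit

theorem IsProperCyclicUnitaryModel.existsUnique_isProperCMV {H : Type*} [NormedAddCommGroup H]
    [InnerProductSpace ℂ H] [CompleteSpace H] {U : H ≃ₗᵢ[ℂ] H} {v₀ : H}
    (h : IsProperCyclicUnitaryModel U v₀) :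
    ∃! C : ell2 ≃ₗᵢ[ℂ] ell2, IsProperCMV C ∧ ModelEquiv U v₀ C (delta 0) := by
  obtain ⟨C, hC, hUC⟩ := h.exists_isProperCMV
  refine ⟨C, ⟨hC, hUC⟩, fun C' hC' => hC'.1.eq_of_modelCoeff_eq hC ?_⟩
  rw [hC'.2.modelCoeff_eq, hUC.modelCoeff_eq]

/-! ### Spectral measures of unitary operators -/

open MeasureTheory

/-- A positive functional on the complex continuous functions on a compact space is integration
against a measure. -/
theorem exists_measure_of_nonneg {X : Type*} [TopologicalSpace X] [CompactSpace X] [T2Space X]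
    [MeasurableSpace X] [BorelSpace X] (Λ : C(X, ℂ) →ₗ[ℂ] ℂ)
    (hΛ : ∀ f : C(X, ℂ), ∃ r : ℝ, 0 ≤ r ∧ Λ (star f * f) = (r : ℂ)) :
    ∃ μ : Measure X, IsFiniteMeasure μ ∧ ∀ f : C(X, ℂ), ∫ z, f z ∂μ = Λ f := by
  let J : C(X, ℝ) → C(X, ℂ) := fun f => ⟨fun z => (f z : ℂ), by fun_prop⟩
  have him : ∀ f, (Λ (J f)).im = 0 := by
    intro f
    -- Polarization: 4f = (f + 1)² − (f − 1)² writes a real function through squares, on which Λ is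
    -- real.
    have e : J f = (1 / 4 : ℂ) • (star (J f + 1) * (J f + 1)) -
        (1 / 4 : ℂ) • (star (J f - 1) * (J f - 1)) := by
      ext z
      simp [J]
      ring
    obtain ⟨r, -, hr⟩ := hΛ (J f + 1)
    obtain ⟨s, -, hs⟩ := hΛ (J f - 1)
    rw [e, map_sub, map_smul, map_smul, hr, hs]
    simp
  have hnonneg : ∀ f : C(X, ℝ), (∀ z, 0 ≤ f z) → 0 ≤ (Λ (J f)).re := by
    intro f hf
    obtain ⟨r, hr, hr'⟩ := hΛ (J ⟨fun z => √(f z), by fun_prop⟩)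
    have e : J f = star (J ⟨fun z => √(f z), by fun_prop⟩) *
        J ⟨fun z => √(f z), by fun_prop⟩ := by
      ext z
      simp [J, ← Complex.ofReal_mul, Real.mul_self_sqrt (hf z)]
    rw [e, hr']
    exact hr
  let Λr : CompactlySupportedContinuousMap X ℝ →ₗ[ℝ] ℝ :=
    { toFun := fun f => (Λ (J f)).re
      map_add' := fun f g => by
        have : J ((f + g : CompactlySupportedContinuousMap X ℝ) : C(X, ℝ)) = J f + J g := by
          ext z; simp [J]
        rw [this, map_add, Complex.add_re]
      map_smul' := fun c f => by
        have : J ((c • f : CompactlySupportedContinuousMap X ℝ) : C(X, ℝ)) = (c : ℂ) • J f := by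
          ext z; simp [J]
        rw [this, map_smul]
        simp }
  let Λp := PositiveLinearMap.mk₀ Λr fun f hf => hnonneg f fun z => CompactlySupportedContinuousMap.le_def.1 hf z
  have hre : ∀ f : C(X, ℝ), ∫ z, f z ∂(RealRMK.rieszMeasure Λp) = (Λ (J f)).re := fun f =>
    RealRMK.integral_rieszMeasure Λp ⟨f, HasCompactSupport.of_compactSpace _⟩
  have hC : ∀ f : C(X, ℝ), ∫ z, (f z : ℂ) ∂(RealRMK.rieszMeasure Λp) = Λ (J f) := by
    intro f
    rw [integral_complex_ofReal, hre]
    exact Complex.ext rfl (him f).symm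
  refine ⟨RealRMK.rieszMeasure Λp, inferInstance, fun f => ?_⟩
  let fr : C(X, ℝ) := ⟨fun z => (f z).re, by fun_prop⟩
  let fi : C(X, ℝ) := ⟨fun z => (f z).im, by fun_prop⟩
  have e : f = J fr + Complex.I • J fi := by
    ext z
    simp [J, fr, fi, mul_comm Complex.I, Complex.re_add_im]
  have hint : ∀ g : C(X, ℂ), Integrable g (RealRMK.rieszMeasure Λp) := fun g =>
    g.continuous.integrable_of_hasCompactSupport (HasCompactSupport.of_compactSpace _)
  rw [e, map_add, map_smul, ← hC, ← hC]
  calc ∫ z, (J fr + Complex.I • J fi) z ∂(RealRMK.rieszMeasure Λp)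
      = ∫ z, (J fr z + Complex.I • J fi z) ∂(RealRMK.rieszMeasure Λp) := rfl
    _ = _ := by
      rw [integral_add (hint _) (by exact (hint _).smul Complex.I), integral_smul]
      rfl

section Spectral

variable {H : Type*} [NormedAddCommGroup H] [InnerProductSpace ℂ H] [CompleteSpace H]

/-- The inclusion of the unit circle into the plane. -/
noncomputable def circleCoe : C(Circle, ℂ) := ⟨fun z => (z : ℂ), continuous_subtype_val⟩

/-- The continuous functional calculus of a unitary operator, on the whole circle. -/
theorem exists_starAlgHom_circle (U : H ≃ₗᵢ[ℂ] H) :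
    ∃ Φ : C(Circle, ℂ) →⋆ₐ[ℂ] (H →L[ℂ] H), Φ circleCoe = (U : H →L[ℂ] H) := by
  have hu : (U : H →L[ℂ] H) ∈ unitary (H →L[ℂ] H) :=
    (Unitary.linearIsometryEquiv.symm U).2
  have hn : IsStarNormal (U : H →L[ℂ] H) := isStarNormal_of_mem_unitary hu
  -- The spectrum lies on the circle, so functions on the circle restrict to it.
  let ι : C(spectrum ℂ (U : H →L[ℂ] H), Circle) :=
    ⟨fun z => ⟨z, spectrum.subset_circle_of_unitary hu z.2⟩, by fun_prop⟩
  exact ⟨(cfcHom hn).comp (ContinuousMap.compStarAlgHom' ℂ ℂ ι), cfcHom_id hn⟩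

theorem aeval_circleCoe_apply (P : Polynomial ℂ) (z : Circle) :
    Polynomial.aeval circleCoe P z = P.eval (z : ℂ) :=
  Polynomial.aeval_continuousMap_apply P circleCoe z

/-- The spectral measure of a vector with respect to a unitary operator. -/
theorem exists_spectralMeasure (U : H ≃ₗᵢ[ℂ] H) (v₀ : H) :
    ∃ μ : Measure Circle, IsFiniteMeasure μ ∧ ∀ P Q : Polynomial ℂ,
      ∫ z : Circle, conj (P.eval (z : ℂ)) * Q.eval (z : ℂ) ∂μ =
        inner ℂ (polyOrbit U v₀ P) (polyOrbit U v₀ Q) := by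
  obtain ⟨Φ, hΦ⟩ := exists_starAlgHom_circle U
  let Λ : C(Circle, ℂ) →ₗ[ℂ] ℂ :=
    { toFun := fun f => inner ℂ v₀ (Φ f v₀)
      map_add' := fun f g => by simp
      map_smul' := fun c f => by simp }
  have hstar : ∀ f g, Λ (star f * g) = inner ℂ (Φ f v₀) (Φ g v₀) := by
    intro f g
    have e : Φ (star f * g) v₀ = ContinuousLinearMap.adjoint (Φ f) (Φ g v₀) := by
      rw [map_mul, map_star]
      rfl
    change inner ℂ v₀ (Φ (star f * g) v₀) = _
    rw [e, ContinuousLinearMap.adjoint_inner_right]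
  have hpoly : ∀ P, Φ (Polynomial.aeval circleCoe P) v₀ = polyOrbit U v₀ P := by
    intro P
    rw [polyOrbit_apply, ← hΦ]
    exact congrArg (fun T : H →L[ℂ] H => T v₀) (Polynomial.aeval_algHom_apply Φ circleCoe P).symm
  obtain ⟨μ, hμ, h⟩ := exists_measure_of_nonneg Λ fun f =>
    ⟨‖Φ f v₀‖ ^ 2, sq_nonneg _, by rw [hstar, inner_self_eq_norm_sq_to_K]; simp⟩
  refine ⟨μ, hμ, fun P Q => ?_⟩
  rw [← hpoly, ← hpoly, ← hstar, ← h]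
  simp only [ContinuousMap.mul_apply, ContinuousMap.star_apply, aeval_circleCoe_apply]
  rfl

/-- The Verblunsky coefficients of a proper model are those of a nontrivial probability measure. -/
theorem IsProperCyclicUnitaryModel.exists_isVerblunskyCoefficients {U : H ≃ₗᵢ[ℂ] H} {v₀ : H}
    (h : IsProperCyclicUnitaryModel U v₀) :
    ∃ μ : Measure Circle, IsProbabilityMeasure μ ∧ IsNontrivialMeasure μ ∧
      IsVerblunskyCoefficients μ (modelCoeff U v₀) := by
  have hα := h.norm_modelCoeff_lt_one
  obtain ⟨μ, hμ, hint⟩ := exists_spectralMeasure U v₀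
  refine ⟨μ, ⟨?_⟩, fun s hs hs0 => ?_, hα, fun n => (szegoPoly (modelCoeff U v₀) n).1,
    ⟨natDegree_szegoPoly_fst hα, fun n => ?_, fun n j hj => ?_, fun n => ?_⟩,
    szegoPoly_recursion hα⟩
  · have h1 := hint 1 1
    rw [polyOrbit_one, inner_self_eq_norm_sq_to_K, h.norm_eq_one] at h1
    have h2 : μ.real Set.univ = 1 := Complex.ofReal_injective (by simpa using h1)
    rw [← ENNReal.toReal_eq_one_iff]
    exact h2
  · let Q : Polynomial ℂ := ∏ z ∈ hs.toFinset, (Polynomial.X - Polynomial.C (z : ℂ))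
    have hQ : Q ≠ 0 := Finset.prod_ne_zero_iff.2 fun z _ => Polynomial.X_sub_C_ne_zero _
    have h1 := hint Q Q
    rw [integral_eq_zero_of_ae] at h1
    · exact h.infinite_dimensional (h.finiteDimensional hQ (inner_self_eq_zero.1 h1.symm))
    · filter_upwards [mem_ae_iff.2 hs0] with z hz
      have : Q.eval (z : ℂ) = 0 := by
        rw [Polynomial.eval_prod]
        exact Finset.prod_eq_zero (hs.mem_toFinset.2 hz) (by simp)
      simp [this]
  · obtain ⟨κ, hκ, h1⟩ := coeff_szegoPoly_fst_self (n := n) fun k _ => hα k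
    exact ⟨κ, hκ, by rw [Polynomial.leadingCoeff, natDegree_szegoPoly_fst hα, h1]⟩
  · have h1 := hint (Polynomial.X ^ j) (szegoPoly (modelCoeff U v₀) n).1
    rw [polyOrbit_X_pow, ← szego_fst,
      (szego_orthogonal h.norm_eq_one fun k _ => hα k).2.2.1 j hj] at h1
    simpa using h1
  · have h1 := hint (szegoPoly (modelCoeff U v₀) n).1 (szegoPoly (modelCoeff U v₀) n).1
    rw [← szego_fst,
      (szego_orthogonal h.norm_eq_one fun k _ => hα k).1] at h1
    apply Complex.ofReal_injective
    rw [← integral_complex_ofReal, Complex.ofReal_one, ← h1]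
    refine integral_congr_ae (Filter.Eventually.of_forall fun z => ?_)
    simp [Complex.conj_mul']

end Spectral

/-- **Verblunsky's theorem**. -/
theorem exists_isVerblunskyCoefficients {α : ℕ → ℂ} (hα : ∀ n, ‖α n‖ < 1) :
    ∃ μ : Measure Circle, IsProbabilityMeasure μ ∧ IsNontrivialMeasure μ ∧
      IsVerblunskyCoefficients μ α := by
  obtain ⟨C, x, hx⟩ := exists_unitary_isCMVPair hα
  have hC : IsProperCMV C := ⟨α, hα, (hasMatrix_matC_iff hα).2 ⟨x, hx⟩⟩
  -- The measure is the spectral measure of δ₀, and the coefficients of this model are α itself.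
  have h := hC.isProperCyclicUnitaryModel.exists_isVerblunskyCoefficients
  rwa [hx.modelCoeff_eq hα orthonormal_delta] at h

end CMV

theorem theorem2p2 :
    -- every proper CMV matrix is the matrix of exactly one unitary operator on `ℓ²`
    (∀ α : ℕ → ℂ, (∀ n, ‖α n‖ < 1) →
      ∃! C : CMV.ell2 ≃ₗᵢ[ℂ] CMV.ell2, CMV.HasMatrix C (CMV.matC α)) ∧
    -- for which `δ₀` is cyclic, so that `(ℓ², 𝒞, δ₀)` is a proper cyclic unitary model
    (∀ C : CMV.ell2 ≃ₗᵢ[ℂ] CMV.ell2, CMV.IsProperCMV C →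
      CMV.IsProperCyclicUnitaryModel C (CMV.delta 0)) ∧
    -- every equivalence class of proper models contains exactly one proper CMV model
    (∀ (H : Type*) [NormedAddCommGroup H] [InnerProductSpace ℂ H] [CompleteSpace H]
      (U : H ≃ₗᵢ[ℂ] H) (v₀ : H), CMV.IsProperCyclicUnitaryModel U v₀ →
      ∃! C : CMV.ell2 ≃ₗᵢ[ℂ] CMV.ell2,
        CMV.IsProperCMV C ∧ CMV.ModelEquiv U v₀ C (CMV.delta 0)) ∧
    -- Verblunsky's theorem
    (∀ α : ℕ → ℂ, (∀ n, ‖α n‖ < 1) →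
      ∃ μ : MeasureTheory.Measure Circle, MeasureTheory.IsProbabilityMeasure μ ∧
        CMV.IsNontrivialMeasure μ ∧ CMV.IsVerblunskyCoefficients μ α) :=
  ⟨fun _ hα => CMV.existsUnique_hasMatrix hα, fun _ hC => hC.isProperCyclicUnitaryModel,
    fun _ _ _ _ _ _ h => h.existsUnique_isProperCMV,
    fun _ hα => CMV.exists_isVerblunskyCoefficients hα⟩
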